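/- **Setting.** Consider $s$ interconnected subsystems with states $x_i(k)\in\mathbb R^{n_i}$ and measurements $z_i(k)\in\mathbb R^{m_i}$, $$x_i(k)=\sum_{j\in\mathbb I_i(k-1)\cup\{i\}}A_{ij}(k-1)x_j(k-1)+w_i(k-1),\qquad z_i(k)=C_i(k)x_i(k)+v_i(k),\qquad k\ge 1,$$ where $\mathbb I_i(k)=\{j\ne i: A_{ij}(k)\ne 0\}$ and $\mathbb O_i(k)=\{j\neq i: A_{ji}(k)\neq 0\}$ are the sets of in- and out-neighbors. Let $A(k)=[A_{ij}(k)]$, $C(k)=\mathrm{Diag}(C_1(k),\dots,C_s(k))$, and write $w(k),v(k)$ for the stacked noises; $\|\cdot\|$ is the Euclidean norm of vectors and the induced 2-norm of matrices. Assume that $\{\|A(k)\|\}_{k\ge0}$, $\{\|C(k)\|\}_{k\ge1}$, $\{\|w(k)\|\}_{k\ge0}$, $\{\|v(k)\|\}_{k\ge1}$ are bounded and that $(C(k),A(k))$, $k\ge 1$, is uniformly detectable. With $\Phi_X(k+t,k)=X(k+t-1)\cdots X(k)$ and $\Phi_X(k,k)=I$: a pair $(Y(k),X(k))$ is *uniformly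 detectable* if there are integers $\nu\ge\mu\ge0$ and reals $0\le\gamma<1$, $\sigma>0$ such that, for all $k$ and $\xi$, $\|\Phi_X(k+\mu,k)\xi\|\ge\gamma\|\xi\|$ implies $\xi^\top\sum_{i=0}^{\nu}\Phi_X^\top(k+i,k)Y^\top(k+i)Y(k+i)\Phi_X(k+i,k)\xi\ge\sigma\|\xi\|^2$; a pair $(X(k),Y(k))$ is *uniformly reachable* if there are an integer $t\ge0$ and a real $r>0$ with $\sum_{i=0}^{t}\Phi_X(k+t+1,k+i+1)Y(k+i)Y^\top(k+i)\Phi_X^\top(k+t+1,k+i+1)\ge rI$ for all $k\ge 0$. The distributed estimator is, for $k\ge1$ and an arbitrary initial estimate $\hat x(0)$, $$\bar x_i(k)=\sum_{j\in\mathbb I_i(k-1)\cup\{i\}}A_{ij}(k-1)\hat x_j(k-1),\qquad \hat x_i(k)=\bar x_i(k)+K_i(k)\bigl(z_i(k)-C_i(k)\bar x_i(k)\bigr),$$ $$K_i(k)=\bar P_i(k)C_i^\top(k)\bigl(C_i(k)\bar P_i(k)C_i^\top(k)+R_i(k)\bigr)^{-1},$$ where, starting from some $P_i(0)\ge0$,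 the distributed modified Riccati equation (DMRE) is $$\bar P_i(k+1)=\vartheta_i^2(k)\sum_{j\in\mathbb I_i(k)\cup\{i\}}A_{ij}(k)P_j(k)A_{ij}^\top(k)+Q_i(k),\quad k\ge0,$$ $$P_i(k)=\bar P_i(k)-\bar P_i(k)C_i^\top(k)\bigl(C_i(k)\bar P_i(k)C_i^\top(k)+R_i(k)\bigr)^{-1}C_i(k)\bar P_i(k),\quad k\ge1.$$ **Theorem 1.** Suppose that $\vartheta_i(k)=\sqrt{|\mathbb O_i(k+1)|+1}$ for all $i$ and $k\ge0$, and that for every $i$: 1. $\bigl(A_{ii}(k),\sqrt{Q_i(k)}\bigr)$ is uniformly reachable; 2. there are $q_{u,i}\ge0$ and $r_{u,i}\ge r_{l,i}>0$ with $0\le Q_i(k)\le q_{u,i}I$ and $r_{l,i}I\le R_i(k+1)\le r_{u,i}I$ for all $k\ge0$; 3. there is $p_{u,i}\ge0$ with $P_i(k)\le p_{u,i}I$ for all $k\ge0$. Then the estimation error $\hat e(k)=x(k)-\hat x(k)$ is exponentially stable: there are constants $a\ge0$, $0\le b<1$, $c\ge0$ such that $$\|\hat e(k)\|\le a\,b^k+c\qquad\text{for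 all }k\ge0,$$ and, if moreover $w(k)=0$ and $v(k+1)=0$ for all $k\ge0$, $$\|\hat e(k)\|\le a\,b^k\qquad\text{for all }k\ge0.$$ Here $b$ depends only on the matrices of the system and of the DMRE, $a$ only on these and on an upper bound for $\|\hat e(0)\|$, and $c$ in addition only on an upper bound for the noise norms. -/

import Mathlib

open Matrix
open scoped MatrixOrder Matrix.Norms.L2Operator

noncomputable section

/-- The Euclidean norm of a finite real vector. -/
def euclNorm {p : Type*} [Fintype p] (v : p → ℝ) : ℝ := ‖WithLp.toLp 2 v‖

/-- The transition matrix `Φ_X(k + t, k) = X(k + t - 1) ⋯ X(k)`, equal to `I` for `t = 0`. -/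
def transition {p : Type*} [Fintype p] [DecidableEq p] (X : ℕ → Matrix p p ℝ) (k : ℕ) :
    ℕ → Matrix p p ℝ
  | 0 => 1
  | t + 1 => X (k + t) * transition X k t

/-- Uniform reachability of the time-varying pair `(X(k), Y(k))`, `k ≥ 0`.
For `i ≤ t` the matrix `Φ_X(k + t + 1, k + i + 1)` is a product of `t - i` factors. -/
def UniformlyReachable {p q : Type*} [Fintype p] [DecidableEq p] [Fintype q]
    (X : ℕ → Matrix p p ℝ) (Y : ℕ → Matrix p q ℝ) : Prop :=
  ∃ (t : ℕ) (r : ℝ), 0 < r ∧ ∀ k : ℕ,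
    r • (1 : Matrix p p ℝ) ≤ ∑ i ∈ Finset.range (t + 1),
      transition X (k + i + 1) (t - i) * Y (k + i) * (Y (k + i))ᵀ *
        (transition X (k + i + 1) (t - i))ᵀ

/-- Uniform detectability of the time-varying pair `(Y(k), X(k))` over the times `k ≥ k₀`
at which both sequences are defined. -/
def UniformlyDetectableFrom {p q : Type*} [Fintype p] [DecidableEq p] [Fintype q]
    (k₀ : ℕ) (Y : ℕ → Matrix q p ℝ) (X : ℕ → Matrix p p ℝ) : Prop :=
  ∃ (μ ν : ℕ) (γ σ : ℝ), μ ≤ ν ∧ 0 ≤ γ ∧ γ < 1 ∧ 0 < σ ∧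
    ∀ (k : ℕ) (ξ : p → ℝ), k₀ ≤ k →
      γ * euclNorm ξ ≤ euclNorm (transition X k μ *ᵥ ξ) →
      σ * euclNorm ξ ^ 2 ≤
        ξ ⬝ᵥ ((∑ i ∈ Finset.range (ν + 1),
          (transition X k i)ᵀ * (Y (k + i))ᵀ * Y (k + i) * transition X k i) *ᵥ ξ)

/-- A family of local vectors, one in each `ℝ^(d i)`. -/
abbrev BlockVec {s : ℕ} (d : Fin s → ℕ) : Type := ∀ i : Fin s, Fin (d i) → ℝ

/-- The stacked vector `[v₁; …; v_s]`. -/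
def stack {s : ℕ} {d : Fin s → ℕ} (v : BlockVec d) : (Σ i : Fin s, Fin (d i)) → ℝ :=
  fun p => v p.1 p.2

/-- A family of local square matrices, one for each subsystem (a block diagonal matrix). -/
abbrev BlockMat {s : ℕ} (d : Fin s → ℕ) : Type :=
  ∀ i : Fin s, Matrix (Fin (d i)) (Fin (d i)) ℝ

/-- The matrices of a time-varying large-scale interconnected system with `s` subsystems:
`A k i j` is the block `A_ij(k)`, `k ≥ 0`, and `C k i` is the local measurement matrix
`C_i(k)`, `k ≥ 1` (the value at `k = 0` is never used). -/
structure LIS (s : ℕ) (n m : Fin s → ℕ) where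
  A : ℕ → ∀ i j : Fin s, Matrix (Fin (n i)) (Fin (n j)) ℝ
  C : ℕ → ∀ i : Fin s, Matrix (Fin (m i)) (Fin (n i)) ℝ

/-- The adjustable parameters of the estimator: the decoupling variables `ϑ_i(k)`, the matrices
`Q_i(k)`, `k ≥ 0`, and `R_i(k)`, `k ≥ 1` (the value at `k = 0` is never used), and the initial
value `P_i(0)` of the recursion. -/
structure EstimatorParams (s : ℕ) (n m : Fin s → ℕ) where
  ϑ : ℕ → Fin s → ℝ
  Q : ℕ → BlockMat n
  R : ℕ → BlockMat m
  P₀ : BlockMat n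

namespace LIS

variable {s : ℕ} {n m : Fin s → ℕ}

/-- The global system matrix `A(k)`. -/
def globalA (S : LIS s n m) (k : ℕ) :
    Matrix (Σ i : Fin s, Fin (n i)) (Σ i : Fin s, Fin (n i)) ℝ :=
  Matrix.of fun p q => S.A k p.1 q.1 p.2 q.2

/-- The global measurement matrix `C(k) = Diag(C₁(k), …, C_s(k))`. -/
def globalC (S : LIS s n m) (k : ℕ) :
    Matrix (Σ i : Fin s, Fin (m i)) (Σ i : Fin s, Fin (n i)) ℝ :=
  Matrix.blockDiagonal' (S.C k)

open Classical in
/-- The in-neighbours `𝕀_i(k) = {j ≠ i | A_ij(k) ≠ 0}`. -/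
def inNbrs (S : LIS s n m) (k : ℕ) (i : Fin s) : Finset (Fin s) :=
  Finset.univ.filter fun j => j ≠ i ∧ S.A k i j ≠ 0

open Classical in
/-- The out-neighbours `𝕆_i(k) = {j ≠ i | A_ji(k) ≠ 0}`. -/
def outNbrs (S : LIS s n m) (k : ℕ) (i : Fin s) : Finset (Fin s) :=
  Finset.univ.filter fun j => j ≠ i ∧ S.A k j i ≠ 0

/-- One step of the interconnected dynamics without noise:
`∑_{j ∈ 𝕀_i(k) ∪ {i}} A_ij(k) x_j`. -/
def propagate (S : LIS s n m) (k : ℕ) (x : BlockVec n) : BlockVec n :=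
  fun i => ∑ j ∈ insert i (S.inNbrs k i), S.A k i j *ᵥ x j

/-- The state `x_i(k)` with initial state `x₀` and process noise `w`. -/
def state (S : LIS s n m) (x₀ : BlockVec n) (w : ℕ → BlockVec n) : ℕ → BlockVec n
  | 0 => x₀
  | k + 1 => fun i => S.propagate k (state S x₀ w k) i + w k i

/-- The measurement `z_i(k) = C_i(k) x_i(k) + v_i(k)` of a state trajectory `x`. -/
def measurement (S : LIS s n m) (x : ℕ → BlockVec n) (v : ℕ → BlockVec m) (k : ℕ) : BlockVec m :=
  fun i => S.C k i *ᵥ x k i + v k i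

/-- The map from `P(k)` to `P̄(k+1)`:
`ϑ_i(k)² ∑_{j ∈ 𝕀_i(k) ∪ {i}} A_ij(k) P_j A_ij(k)ᵀ + Q_i(k)`. -/
def predictCov (S : LIS s n m) (E : EstimatorParams s n m) (k : ℕ) (P : BlockMat n) :
    BlockMat n :=
  fun i => E.ϑ k i ^ 2 • (∑ j ∈ insert i (S.inNbrs k i), S.A k i j * P j * (S.A k i j)ᵀ) + E.Q k i

/-- The map from `P̄(k)` to `P(k)`. -/
def correctCov (S : LIS s n m) (E : EstimatorParams s n m) (k : ℕ) (Pb : BlockMat n) :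
    BlockMat n :=
  fun i => Pb i - Pb i * (S.C k i)ᵀ * (S.C k i * Pb i * (S.C k i)ᵀ + E.R k i)⁻¹ * S.C k i * Pb i

/-- The solution `P_i(k)`, `k ≥ 0`, of the distributed modified Riccati equation. -/
def P (S : LIS s n m) (E : EstimatorParams s n m) : ℕ → BlockMat n
  | 0 => E.P₀
  | k + 1 => S.correctCov E (k + 1) (S.predictCov E k (P S E k))

/-- The solution `P̄_i(k)`, `k ≥ 1`, of the distributed modified Riccati equation
(the value at `k = 0` is never used). -/
def Pbar (S : LIS s n m) (E : EstimatorParams s n m) : ℕ → BlockMat n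
  | 0 => 0
  | k + 1 => S.predictCov E k (S.P E k)

/-- The local gain
`K_i(k) = P̄_i(k) C_i(k)ᵀ (C_i(k) P̄_i(k) C_i(k)ᵀ + R_i(k))⁻¹`, `k ≥ 1`. -/
def gain (S : LIS s n m) (E : EstimatorParams s n m) (k : ℕ) (i : Fin s) :
    Matrix (Fin (n i)) (Fin (m i)) ℝ :=
  S.Pbar E k i * (S.C k i)ᵀ * (S.C k i * S.Pbar E k i * (S.C k i)ᵀ + E.R k i)⁻¹

/-- The distributed estimate `x̂_i(k)` computed from the measurements `z` and the initial estimate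
`xh₀`: with `x̄ = propagate (k) (x̂(k))`,
`x̂_i(k+1) = x̄_i + K_i(k+1) (z_i(k+1) - C_i(k+1) x̄_i)`. -/
def estimate (S : LIS s n m) (E : EstimatorParams s n m) (xh₀ : BlockVec n)
    (z : ℕ → BlockVec m) : ℕ → BlockVec n
  | 0 => xh₀
  | k + 1 => fun i =>
      S.propagate k (estimate S E xh₀ z k) i +
        S.gain E (k + 1) i *ᵥ
          (z (k + 1) i - S.C (k + 1) i *ᵥ S.propagate k (estimate S E xh₀ z k) i)

/-- The estimation error `ê_i(k) = x_i(k) - x̂_i(k)` of the distributed estimator running on the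
measurements of the system with initial state `x₀`, initial estimate `xh₀`, process noise `w` and
measurement noise `v`. -/
def estError (S : LIS s n m) (E : EstimatorParams s n m) (x₀ xh₀ : BlockVec n)
    (w : ℕ → BlockVec n) (v : ℕ → BlockVec m) (k : ℕ) : BlockVec n :=
  fun i => S.state x₀ w k i - S.estimate E xh₀ (S.measurement (S.state x₀ w) v) k i

end LIS

end

/-!
Let `ē(k+1) = A(k) ê(k)` be the stacked prediction error, so that without noise
`ê(k) = ē(k) - K(k) C(k) ē(k)`. The proof is a Lyapunov argument with the energy
`W(k) = ∑ᵢ (|𝕆ᵢ(k)| + 1) ēᵢ(k)ᵀ P̄ᵢ(k)⁻¹ ēᵢ(k)` (`LIS.energy`).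

* *Dissipation* (`LIS.HasBounds.energy_succ_le`). In the coordinates `fᵢ = P̄ᵢ⁻¹ ēᵢ` the corrected
  error is `êᵢ = Pᵢ fᵢ`, of energy `fᵢᵀ Pᵢ fᵢ`, which is that of `ēᵢ` less a multiple of
  `‖Cᵢ ēᵢ‖²`. By Young's inequality and `P̄ᵢ(k+1) ≥ ϑᵢ²(k) ∑ⱼ Aᵢⱼ Pⱼ Aᵢⱼᵀ`, the energy
  `ϑᵢ²(k) ēᵢᵀ P̄ᵢ⁻¹ ēᵢ` at time `k+1` is at most `∑ⱼ fⱼᵀ Pⱼ fⱼ` over `j ∈ 𝕀ᵢ(k) ∪ {i}`. Summed over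
  `i`, each `j` is counted `|𝕆ⱼ(k)| + 1` times. Since `ϑᵢ²(k) = |𝕆ᵢ(k+1)| + 1`, these are the
  weights of `W(k)` on the right and those of `W(k+1)` on the left, hence
  `W(k+1) ≤ W(k) - const · ‖C(k) ē(k)‖²`.
* *Equivalence of `W` and `‖ē‖²`*. The covariances are bounded above by assumption. A measurement
  update costs at most a constant factor, `P ≥ α P̄`
  (`IsBoundedUpdate.mul_quadForm_le_correction`), so that `P̄ᵢ(k+1) ≥ α Aᵢᵢ P̄ᵢ(k) Aᵢᵢᵀ + Qᵢ(k)`, and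
  iterating this over a reachability window bounds `P̄ᵢ` below by a multiple of the Gramian
  (`LIS.HasBounds.exists_le_quadForm_Pbar`).
* *Decay*. Uniform detectability survives the output injection by the gain
  (`UniformlyDetectableFrom.exists_injection_bound`): `‖ē(k+μ)‖ ≤ γ ‖ē(k)‖ + const · (outputs in a
  window)`. With the dissipation inequality this makes a combination of window sums of `‖ē‖²` and
  `W` contract at each step (`exists_geometric_decay`).

The homogeneous error recursion is thus exponentially stable, uniformly in the starting time, and
superposition (`euclNorm_le_of_transition_bound`) handles bounded noise.
-/

/-! ### Euclidean norms and quadratic forms -/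

section QuadraticForms

variable {p q : Type*} [Fintype p] [Fintype q]

lemma euclNorm_sq (v : p → ℝ) : euclNorm v ^ 2 = v ⬝ᵥ v := by
  rw [euclNorm, EuclideanSpace.norm_sq_eq]
  simp [dotProduct, sq]

lemma euclNorm_nonneg (v : p → ℝ) : 0 ≤ euclNorm v := norm_nonneg _

lemma euclNorm_zero : euclNorm (0 : p → ℝ) = 0 := by simp [euclNorm]

lemma euclNorm_add_le (v w : p → ℝ) : euclNorm (v + w) ≤ euclNorm v + euclNorm w := by
  simpa [euclNorm] using norm_add_le (WithLp.toLp 2 v) (WithLp.toLp 2 w)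

lemma euclNorm_neg (v : p → ℝ) : euclNorm (-v) = euclNorm v := by
  simp [euclNorm]

lemma euclNorm_sub_le (v w : p → ℝ) : euclNorm (v - w) ≤ euclNorm v + euclNorm w := by
  simpa [euclNorm] using norm_sub_le (WithLp.toLp 2 v) (WithLp.toLp 2 w)

lemma dotProduct_le_euclNorm_mul (v w : p → ℝ) : v ⬝ᵥ w ≤ euclNorm v * euclNorm w := by
  have := real_inner_le_norm (WithLp.toLp 2 w) (WithLp.toLp 2 v)
  simpa [euclNorm, EuclideanSpace.inner_eq_star_dotProduct, mul_comm] using this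

lemma euclNorm_mulVec_le [DecidableEq p] (M : Matrix q p ℝ) (v : p → ℝ) :
    euclNorm (M *ᵥ v) ≤ ‖M‖ * euclNorm v :=
  l2_opNorm_mulVec M (WithLp.toLp 2 v)

lemma euclNorm_comp_le {f : q → p} (hf : f.Injective) (v : p → ℝ) :
    euclNorm (v ∘ f) ≤ euclNorm v := by
  refine le_of_abs_le (abs_le_of_sq_le_sq ?_ (euclNorm_nonneg _))
  rw [euclNorm_sq, euclNorm_sq]
  exact (Finset.sum_map Finset.univ ⟨f, hf⟩ fun i => v i * v i).symm.trans_le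
    (Finset.sum_le_univ_sum_of_nonneg fun i => mul_self_nonneg _)

lemma euclNorm_extend {f : q → p} (hf : f.Injective) (v : q → ℝ) :
    euclNorm (Function.extend f v 0) = euclNorm v := by
  refine (sq_eq_sq₀ (euclNorm_nonneg _) (euclNorm_nonneg _)).1 ?_
  rw [euclNorm_sq, euclNorm_sq]
  symm
  refine Fintype.sum_of_injective f hf _ _ (fun i hi => ?_) fun i => ?_
  · rw [Function.extend_apply' _ _ _ (by simpa using hi)]; simp
  · simp [hf.extend_apply]

lemma euclNorm_submatrix_mulVec_le {p' q' : Type*} [Fintype p'] [Fintype q'] [DecidableEq p]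
    (M : Matrix q p ℝ) {f : q' → q} {g : p' → p} (hf : f.Injective) (hg : g.Injective)
    (v : p' → ℝ) : euclNorm (M.submatrix f g *ᵥ v) ≤ ‖M‖ * euclNorm v := by
  have h : M.submatrix f g *ᵥ v = (M *ᵥ Function.extend g v 0) ∘ f := by
    ext i
    refine Fintype.sum_of_injective g hg _ _ (fun j hj => ?_) fun j => ?_
    · rw [Function.extend_apply' _ _ _ (by simpa using hj)]; simp
    · simp [hg.extend_apply]
  rw [h, ← euclNorm_extend hg v]
  exact (euclNorm_comp_le hf _).trans (euclNorm_mulVec_le M _)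

lemma dotProduct_mul_mul_transpose_mulVec (B : Matrix p q ℝ) (M : Matrix q q ℝ) (x : p → ℝ) :
    x ⬝ᵥ ((B * M * Bᵀ) *ᵥ x) = (Bᵀ *ᵥ x) ⬝ᵥ (M *ᵥ (Bᵀ *ᵥ x)) := by
  rw [← mulVec_mulVec, ← mulVec_mulVec, dotProduct_mulVec, ← mulVec_transpose]

lemma Matrix.IsHermitian.dotProduct_mulVec_comm {M : Matrix p p ℝ} (hM : M.IsHermitian)
    (x y : p → ℝ) : x ⬝ᵥ (M *ᵥ y) = y ⬝ᵥ (M *ᵥ x) := by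
  rw [dotProduct_mulVec, ← mulVec_transpose, ← conjTranspose_eq_transpose_of_trivial, hM.eq,
    dotProduct_comm]

lemma Matrix.PosSemidef.quadForm_nonneg {M : Matrix p p ℝ} (hM : M.PosSemidef) (x : p → ℝ) :
    0 ≤ x ⬝ᵥ (M *ᵥ x) := by
  simpa using hM.dotProduct_mulVec_nonneg x

/-- Young's inequality for the semi-inner product of a positive semidefinite matrix. -/
lemma Matrix.PosSemidef.two_mul_dotProduct_mulVec_le {M : Matrix p p ℝ} (hM : M.PosSemidef)
    {τ : ℝ} (hτ : 0 < τ) (x y : p → ℝ) :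
    2 * (x ⬝ᵥ (M *ᵥ y)) ≤ τ⁻¹ * (x ⬝ᵥ (M *ᵥ x)) + τ * (y ⬝ᵥ (M *ᵥ y)) := by
  have h := hM.quadForm_nonneg (x - τ • y)
  simp only [mulVec_sub, mulVec_smul, sub_dotProduct, dotProduct_sub, smul_dotProduct,
    dotProduct_smul, smul_eq_mul, hM.isHermitian.dotProduct_mulVec_comm y x] at h
  have h2 : τ⁻¹ * (x ⬝ᵥ (M *ᵥ x)) + τ * (y ⬝ᵥ (M *ᵥ y)) - 2 * (x ⬝ᵥ (M *ᵥ y)) =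
      τ⁻¹ * (x ⬝ᵥ M *ᵥ x - τ * x ⬝ᵥ M *ᵥ y - (τ * x ⬝ᵥ M *ᵥ y - τ * (τ * y ⬝ᵥ M *ᵥ y))) := by
    field_simp; ring
  have := mul_nonneg (inv_nonneg.2 hτ.le) h
  linarith

lemma quadForm_le_of_le [DecidableEq p] {M N : Matrix p p ℝ} (h : M ≤ N) (x : p → ℝ) :
    x ⬝ᵥ (M *ᵥ x) ≤ x ⬝ᵥ (N *ᵥ x) := by
  have := (Matrix.le_iff.1 h).quadForm_nonneg x
  rw [sub_mulVec, dotProduct_sub] at this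
  linarith

lemma quadForm_smul_one [DecidableEq p] (c : ℝ) (x : p → ℝ) :
    x ⬝ᵥ ((c • (1 : Matrix p p ℝ)) *ᵥ x) = c * euclNorm x ^ 2 := by
  rw [smul_mulVec, one_mulVec, dotProduct_smul, euclNorm_sq, smul_eq_mul]

lemma Matrix.PosSemidef.euclNorm_mulVec_sq_le {M : Matrix p p ℝ} (hM : M.PosSemidef) {c : ℝ}
    (hc : 0 < c) (h : ∀ x, x ⬝ᵥ (M *ᵥ x) ≤ c * euclNorm x ^ 2) (x : p → ℝ) :
    euclNorm (M *ᵥ x) ^ 2 ≤ c * (x ⬝ᵥ (M *ᵥ x)) := by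
  have h1 := hM.two_mul_dotProduct_mulVec_le hc (M *ᵥ x) x
  have h2 := mul_le_mul_of_nonneg_left (h (M *ᵥ x)) (inv_nonneg.2 hc.le)
  rw [← mul_assoc, inv_mul_cancel₀ hc.ne', one_mul] at h2
  rw [← euclNorm_sq] at h1
  linarith

lemma Matrix.PosSemidef.euclNorm_mulVec_le {M : Matrix p p ℝ} (hM : M.PosSemidef) {c : ℝ}
    (hc : 0 < c) (h : ∀ x, x ⬝ᵥ (M *ᵥ x) ≤ c * euclNorm x ^ 2) (x : p → ℝ) :
    euclNorm (M *ᵥ x) ≤ c * euclNorm x := by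
  refine le_of_abs_le (abs_le_of_sq_le_sq ?_ (mul_nonneg hc.le (euclNorm_nonneg _)))
  calc _ ≤ c * (x ⬝ᵥ (M *ᵥ x)) := hM.euclNorm_mulVec_sq_le hc h x
    _ ≤ c * (c * euclNorm x ^ 2) := by gcongr; exact h x
    _ = _ := by ring

lemma posDef_of_le_quadForm {M : Matrix p p ℝ} (hM : M.IsHermitian) {c : ℝ}
    (hc : 0 < c) (h : ∀ x, c * euclNorm x ^ 2 ≤ x ⬝ᵥ (M *ᵥ x)) : M.PosDef := by
  refine PosDef.of_dotProduct_mulVec_pos hM fun x hx => ?_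
  have : 0 < euclNorm x ^ 2 := by
    rw [euclNorm_sq]
    exact lt_of_le_of_ne (by rw [← euclNorm_sq]; positivity)
      fun h0 => hx (dotProduct_self_eq_zero.1 h0.symm)
  simpa using (mul_pos hc this).trans_le (h x)

variable [DecidableEq p]

lemma Matrix.PosDef.mulVec_inv_mulVec {M : Matrix p p ℝ} (hM : M.PosDef) (x : p → ℝ) :
    M *ᵥ (M⁻¹ *ᵥ x) = x := by
  rw [mulVec_mulVec, mul_nonsing_inv _ ((isUnit_iff_isUnit_det _).1 hM.isUnit), one_mulVec]

lemma Matrix.PosDef.quadForm_inv {M : Matrix p p ℝ} (hM : M.PosDef) (x : p → ℝ) :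
    (M⁻¹ *ᵥ x) ⬝ᵥ (M *ᵥ (M⁻¹ *ᵥ x)) = x ⬝ᵥ (M⁻¹ *ᵥ x) := by
  rw [hM.mulVec_inv_mulVec, dotProduct_comm]

lemma Matrix.PosDef.euclNorm_sq_le_inv {M : Matrix p p ℝ} (hM : M.PosDef) {c : ℝ}
    (hc : 0 < c) (h : ∀ x, x ⬝ᵥ (M *ᵥ x) ≤ c * euclNorm x ^ 2) (x : p → ℝ) :
    euclNorm x ^ 2 ≤ c * (x ⬝ᵥ (M⁻¹ *ᵥ x)) := by
  have := hM.posSemidef.euclNorm_mulVec_sq_le hc h (M⁻¹ *ᵥ x)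
  rwa [hM.quadForm_inv, hM.mulVec_inv_mulVec] at this

lemma Matrix.PosDef.mul_quadForm_inv_le {M : Matrix p p ℝ} (hM : M.PosDef) {c : ℝ}
    (hc : 0 < c) (h : ∀ x, c * euclNorm x ^ 2 ≤ x ⬝ᵥ (M *ᵥ x)) (x : p → ℝ) :
    c * (x ⬝ᵥ (M⁻¹ *ᵥ x)) ≤ euclNorm x ^ 2 := by
  have h1 := h (M⁻¹ *ᵥ x)
  rw [hM.quadForm_inv] at h1
  have h2 := dotProduct_le_euclNorm_mul x (M⁻¹ *ᵥ x)
  nlinarith [sq_nonneg (euclNorm x - c * euclNorm (M⁻¹ *ᵥ x))]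

lemma Matrix.PosDef.mul_euclNorm_inv_mulVec_le {M : Matrix p p ℝ} (hM : M.PosDef) {c : ℝ}
    (hc : 0 < c) (h : ∀ x, c * euclNorm x ^ 2 ≤ x ⬝ᵥ (M *ᵥ x)) (x : p → ℝ) :
    c * euclNorm (M⁻¹ *ᵥ x) ≤ euclNorm x := by
  have h1 := h (M⁻¹ *ᵥ x)
  rw [hM.quadForm_inv] at h1
  have h2 := hM.mul_quadForm_inv_le hc h x
  refine le_of_abs_le (abs_le_of_sq_le_sq ?_ (euclNorm_nonneg _))
  nlinarith

end QuadraticForms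

/-! ### Exponential decay from an energy and a detectability inequality -/

/-- The decay argument, for the sequences `N` of state norms, `Y` of output norms and `W` of
energies: the energy is dissipated by the output only, and a large state must show up in the output
within a window unless it shrinks by the factor `γ` in `μ` steps. The function
`L k = λ ∑_{i < μ} N (k + i) ^ 2 + ∑_{j ≤ ν} W (k + j)` contracts in every single step. -/
lemma exists_geometric_decay {c₁ c₂ c g γ : ℝ} (μ ν : ℕ) (hc₁ : 0 < c₁) (hc₂ : 0 < c₂) (hc : 0 < c)
    (hg : 0 < g) (hγ : 0 ≤ γ) (hγ1 : γ < 1) :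
    ∃ a b : ℝ, 0 ≤ a ∧ 0 < b ∧ b < 1 ∧ ∀ N Y W : ℕ → ℝ, (∀ k, 0 ≤ N k) → (∀ k, 0 ≤ Y k) →
      (∀ k, c₁ * N k ^ 2 ≤ W k) → (∀ k, W k ≤ c₂ * N k ^ 2) →
      (∀ k, W (k + 1) ≤ W k - c * Y k ^ 2) →
      (∀ k, N (k + μ) ≤ γ * N k + g * ∑ j ∈ Finset.range (ν + 1), Y (k + j)) →
      ∀ k, N k ≤ a * b ^ k * N 0 := by
  -- `G` bounds the output term of the squared detectability inequality,
  -- `l` is the weight `λ`, and `L` contracts by the factor `1 - l (1 - γ) / H`, which is enlarged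
  -- to `θ ≥ 1 / 2` because `b = √θ` has to be positive
  set G : ℝ := g ^ 2 / (1 - γ) * (ν + 1) with hG
  have hγ' : 0 < 1 - γ := by linarith
  have hGpos : 0 < G := by positivity
  set l : ℝ := c / G with hl
  have hlpos : 0 < l := by positivity
  set H : ℝ := l * (μ * (c₂ / c₁)) + (ν + 1) * c₂ + l with hH
  have hHl : l ≤ H := by rw [hH]; have : 0 ≤ l * (μ * (c₂ / c₁)) + (ν + 1) * c₂ := by positivity
                         linarith
  have hHpos : 0 < H := hlpos.trans_le hHl
  set θ : ℝ := max (1 - l * (1 - γ) / H) (1 / 2) with hθ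
  have hθpos : 0 < θ := lt_of_lt_of_le (by norm_num) (le_max_right _ _)
  have hθ1 : θ < 1 := max_lt (by have : 0 < l * (1 - γ) / H := by positivity
                                 linarith) (by norm_num)
  refine ⟨√(H / c₁), √θ, Real.sqrt_nonneg _, Real.sqrt_pos.2 hθpos,
    by rw [Real.sqrt_lt' one_pos]; simpa using hθ1, fun N Y W hN hY hW1 hW2 hW hdet k => ?_⟩
  have hsq : ∀ k, N (k + μ) ^ 2 ≤ γ * N k ^ 2 + G * ∑ j ∈ Finset.range (ν + 1), Y (k + j) ^ 2 := by
    intro k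
    have h1 : (∑ j ∈ Finset.range (ν + 1), Y (k + j)) ^ 2 ≤
        (ν + 1) * ∑ j ∈ Finset.range (ν + 1), Y (k + j) ^ 2 := by
      simpa using sq_sum_le_card_mul_sum_sq (s := Finset.range (ν + 1)) (f := fun j => Y (k + j))
    set s := ∑ j ∈ Finset.range (ν + 1), Y (k + j)
    have hs : 0 ≤ s := Finset.sum_nonneg fun j _ => hY _
    -- convexity of the square
    have h2 : (γ * N k + g * s) ^ 2 ≤ γ * N k ^ 2 + g ^ 2 / (1 - γ) * s ^ 2 := by
      have e : γ * N k ^ 2 + g ^ 2 / (1 - γ) * s ^ 2 - (γ * N k + g * s) ^ 2 =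
          γ * (1 - γ) * (N k - g * s / (1 - γ)) ^ 2 := by
        field_simp; ring
      have : 0 ≤ γ * (1 - γ) * (N k - g * s / (1 - γ)) ^ 2 := by positivity
      linarith
    have h3 : N (k + μ) ^ 2 ≤ (γ * N k + g * s) ^ 2 := pow_le_pow_left₀ (hN _) (hdet k) 2
    have h4 := mul_le_mul_of_nonneg_left h1 (by positivity : 0 ≤ g ^ 2 / (1 - γ))
    rw [← mul_assoc] at h4
    linarith
  set Z : ℕ → ℝ := fun k => ∑ j ∈ Finset.range (ν + 1), W (k + j) with hZ
  set V : ℕ → ℝ := fun k => ∑ i ∈ Finset.range μ, N (k + i) ^ 2 with hV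
  have hW0 : ∀ k, 0 ≤ W k := fun k => (by positivity : 0 ≤ c₁ * N k ^ 2).trans (hW1 k)
  have hanti : Antitone W := antitone_nat_of_succ_le fun k => (hW k).trans (by
    have : 0 ≤ c * Y k ^ 2 := by positivity
    linarith)
  have hVs : ∀ k, V (k + 1) = V k - N k ^ 2 + N (k + μ) ^ 2 := by
    intro k
    have h1 := Finset.sum_range_succ (fun i => N (k + i) ^ 2) μ
    have h2 := Finset.sum_range_succ' (fun i => N (k + i) ^ 2) μ
    have h3 : V (k + 1) = ∑ i ∈ Finset.range μ, N (k + (i + 1)) ^ 2 :=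
      Finset.sum_congr rfl fun i _ => by rw [show k + 1 + i = k + (i + 1) by ring]
    rw [h3]
    simp only [hV]
    rw [add_zero] at h2
    linarith
  have hZs : ∀ k, Z (k + 1) ≤ Z k - c * ∑ j ∈ Finset.range (ν + 1), Y (k + j) ^ 2 := by
    intro k
    simp only [hZ]
    rw [Finset.mul_sum, ← Finset.sum_sub_distrib]
    refine Finset.sum_le_sum fun j _ => ?_
    rw [show k + 1 + j = k + j + 1 by ring]
    exact hW _
  have hVle : ∀ k, V k ≤ μ * (c₂ / c₁) * N k ^ 2 := by
    intro k
    have h1 : ∀ i ∈ Finset.range μ, N (k + i) ^ 2 ≤ c₂ / c₁ * N k ^ 2 := by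
      intro i _
      rw [div_mul_eq_mul_div, le_div_iff₀ hc₁, mul_comm]
      exact (hW1 _).trans ((hanti (Nat.le_add_right k i)).trans (hW2 k))
    simpa [mul_assoc] using Finset.sum_le_sum h1
  have hZle : ∀ k, Z k ≤ (ν + 1) * c₂ * N k ^ 2 := by
    intro k
    have h1 : ∀ i ∈ Finset.range (ν + 1), W (k + i) ≤ c₂ * N k ^ 2 := fun i _ =>
      (hanti (Nat.le_add_right k i)).trans (hW2 k)
    simpa [mul_assoc] using Finset.sum_le_sum h1
  have hWZ : ∀ k, W k ≤ Z k := fun k =>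
    Finset.single_le_sum (f := fun j => W (k + j)) (fun j _ => hW0 _) (Finset.mem_range.2 ν.succ_pos)
  have hV0 : ∀ k, 0 ≤ V k := fun k => Finset.sum_nonneg fun i _ => sq_nonneg _
  have hLle : ∀ k, l * V k + Z k ≤ H * N k ^ 2 := by
    intro k
    have h1 := mul_le_mul_of_nonneg_left (hVle k) hlpos.le
    have h2 := hZle k
    have h3 : 0 ≤ l * N k ^ 2 := by positivity
    rw [hH]
    linarith
  have hstep : ∀ k, l * V (k + 1) + Z (k + 1) ≤ θ * (l * V k + Z k) := by
    intro k
    have h0 : l * G = c := by rw [hl]; field_simp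
    have h1 := mul_le_mul_of_nonneg_left (hsq k) hlpos.le
    rw [mul_add, ← mul_assoc l G, h0] at h1
    have h2 := hZs k
    have h3 : (1 - l * (1 - γ) / H) * (l * V k + Z k) ≤ θ * (l * V k + Z k) := by
      have : 0 ≤ l * V k + Z k := by
        have := hV0 k; have := (hW0 k).trans (hWZ k); positivity
      gcongr
      exact le_max_left _ _
    have h4 : l * (1 - γ) / H * (l * V k + Z k) ≤ l * (1 - γ) * N k ^ 2 := by
      rw [div_mul_eq_mul_div, div_le_iff₀ hHpos, mul_assoc (l * (1 - γ)), mul_comm (N k ^ 2)]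
      gcongr
      exact hLle k
    rw [hVs]
    linarith
  have hgeom : ∀ k, l * V k + Z k ≤ θ ^ k * (l * V 0 + Z 0) := by
    intro k
    induction k with
    | zero => simp
    | succ k ih =>
      rw [pow_succ', mul_assoc]
      exact (hstep k).trans (by gcongr)
  refine le_of_abs_le (abs_le_of_sq_le_sq ?_ (by have := hN 0; positivity))
  rw [mul_pow, mul_pow, ← pow_mul, mul_comm k 2, pow_mul, Real.sq_sqrt hθpos.le,
    Real.sq_sqrt (by positivity), div_mul_eq_mul_div, div_mul_eq_mul_div, le_div_iff₀ hc₁]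
  have h1 := hgeom k
  have h2 := mul_le_mul_of_nonneg_left (hLle 0) (pow_nonneg hθpos.le k)
  have h3 := mul_nonneg hlpos.le (hV0 k)
  have h4 := (hW1 k).trans (hWZ k)
  linarith

/-! ### Linear time-varying recursions -/

section Transition

variable {p : Type*} [Fintype p] [DecidableEq p]

lemma transition_succ' (X : ℕ → Matrix p p ℝ) (k t : ℕ) :
    transition X k (t + 1) = transition X (k + 1) t * X k := by
  induction t with
  | zero => simp [transition]
  | succ t ih =>
    rw [transition, ih, transition, Matrix.mul_assoc, show k + (t + 1) = k + 1 + t by ring]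

lemma transition_add (X : ℕ → Matrix p p ℝ) (k t u : ℕ) :
    transition X k (t + u) = transition X (k + t) u * transition X k t := by
  induction u with
  | zero => simp [transition]
  | succ u ih =>
    rw [← add_assoc, transition, ih, transition, Matrix.mul_assoc, add_assoc]

lemma euclNorm_transition_mulVec_le {X : ℕ → Matrix p p ℝ} {M : ℝ} (hM : 0 ≤ M)
    (hX : ∀ k ξ, euclNorm (X k *ᵥ ξ) ≤ M * euclNorm ξ) (k t : ℕ) (ξ : p → ℝ) :
    euclNorm (transition X k t *ᵥ ξ) ≤ M ^ t * euclNorm ξ := by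
  induction t with
  | zero => simp [transition]
  | succ t ih =>
    rw [transition, ← mulVec_mulVec, pow_succ', mul_assoc]
    exact (hX _ _).trans (mul_le_mul_of_nonneg_left ih hM)

/-- Exponential stability from time `k₁` on extends to all starting times, at the price of a larger
constant. -/
lemma exists_transition_bound {X : ℕ → Matrix p p ℝ} {M a b : ℝ} (hM : 1 ≤ M)
    (hX : ∀ k ξ, euclNorm (X k *ᵥ ξ) ≤ M * euclNorm ξ) (ha : 0 ≤ a) (hb : 0 < b) (hb1 : b < 1)
    (k₁ : ℕ) (h : ∀ k, k₁ ≤ k → ∀ t ξ, euclNorm (transition X k t *ᵥ ξ) ≤ a * b ^ t * euclNorm ξ) :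
    ∃ a' : ℝ, 0 ≤ a' ∧ ∀ k t ξ, euclNorm (transition X k t *ᵥ ξ) ≤ a' * b ^ t * euclNorm ξ := by
  have hM0 : 0 ≤ M := by linarith
  refine ⟨(1 + a) * (M ^ k₁ * (b ^ k₁)⁻¹), by positivity, fun k t ξ => ?_⟩
  have hn := euclNorm_nonneg ξ
  rcases le_total t k₁ with ht | ht
  · calc _ ≤ M ^ t * euclNorm ξ := euclNorm_transition_mulVec_le hM0 hX k t ξ
      _ ≤ M ^ k₁ * euclNorm ξ := by gcongr
      _ = 1 * (M ^ k₁ * (b ^ k₁)⁻¹) * b ^ k₁ * euclNorm ξ := by field_simp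
      _ ≤ (1 + a) * (M ^ k₁ * (b ^ k₁)⁻¹) * b ^ t * euclNorm ξ := by
        have := pow_le_pow_of_le_one hb.le hb1.le ht
        gcongr
        linarith
  · obtain ⟨u, rfl⟩ := Nat.exists_eq_add_of_le ht
    rw [transition_add, ← mulVec_mulVec]
    calc _ ≤ a * b ^ u * euclNorm (transition X k k₁ *ᵥ ξ) := h _ (by omega) _ _
      _ ≤ a * b ^ u * (M ^ k₁ * euclNorm ξ) := by
        gcongr; exact euclNorm_transition_mulVec_le hM0 hX k k₁ ξ
      _ = a * (M ^ k₁ * (b ^ k₁)⁻¹) * b ^ (k₁ + u) * euclNorm ξ := by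
        rw [pow_add]; field_simp
      _ ≤ _ := by gcongr; linarith

lemma euclNorm_sub_transition_le {X : ℕ → Matrix p p ℝ} {a b D : ℝ} (ha : 0 ≤ a) (hb : 0 ≤ b)
    (h : ∀ k t ξ, euclNorm (transition X k t *ᵥ ξ) ≤ a * b ^ t * euclNorm ξ)
    {x d : ℕ → p → ℝ} (hx : ∀ k, x (k + 1) = X k *ᵥ x k + d k) (hd : ∀ k, euclNorm (d k) ≤ D)
    (k t : ℕ) :
    euclNorm (x (k + t) - transition X k t *ᵥ x k) ≤ a * D * ∑ j ∈ Finset.range t, b ^ j := by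
  induction t generalizing k with
  | zero => simp [transition, euclNorm_zero]
  | succ t ih =>
    have e : x (k + (t + 1)) - transition X k (t + 1) *ᵥ x k =
        (x (k + 1 + t) - transition X (k + 1) t *ᵥ x (k + 1)) + transition X (k + 1) t *ᵥ d k := by
      rw [transition_succ', ← mulVec_mulVec, hx k, mulVec_add, show k + (t + 1) = k + 1 + t by ring]
      abel
    rw [e, Finset.sum_range_succ, mul_add]
    refine (euclNorm_add_le _ _).trans (add_le_add (ih _) ((h _ _ _).trans ?_))
    calc a * b ^ t * euclNorm (d k) ≤ a * b ^ t * D := by gcongr; exact hd k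
      _ = a * D * b ^ t := by ring

/-- The response of an exponentially stable recursion to a bounded input. -/
lemma euclNorm_le_of_transition_bound {X : ℕ → Matrix p p ℝ} {a b D : ℝ} (ha : 0 ≤ a) (hb : 0 ≤ b)
    (hb1 : b < 1) (h : ∀ k t ξ, euclNorm (transition X k t *ᵥ ξ) ≤ a * b ^ t * euclNorm ξ)
    {x d : ℕ → p → ℝ} (hx : ∀ k, x (k + 1) = X k *ᵥ x k + d k) (hd : ∀ k, euclNorm (d k) ≤ D)
    (k : ℕ) : euclNorm (x k) ≤ a * euclNorm (x 0) * b ^ k + a * D * (1 - b)⁻¹ := by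
  have hD : 0 ≤ D := (euclNorm_nonneg _).trans (hd 0)
  have h1 := euclNorm_sub_transition_le ha hb h hx hd 0 k
  have h2 : ∑ j ∈ Finset.range k, b ^ j ≤ (1 - b)⁻¹ := by
    rw [← tsum_geometric_of_lt_one hb hb1]
    exact (summable_geometric_of_lt_one hb hb1).sum_le_tsum _ fun i _ => pow_nonneg hb i
  have h3 := euclNorm_add_le (transition X 0 k *ᵥ x 0) (x (0 + k) - transition X 0 k *ᵥ x 0)
  rw [add_sub_cancel, zero_add] at h3
  rw [zero_add] at h1
  have h4 := h 0 k (x 0)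
  have h5 := mul_le_mul_of_nonneg_left h2 (mul_nonneg ha hD)
  linarith

/-- Uniform detectability is invariant under bounded output injection, in quantitative form: along a
trajectory of `x(k+1) = X(k) (x(k) + u(k))` with an injection `u` bounded by the output, the state
shrinks by the factor `γ` in `μ` steps up to the outputs in a window. -/
lemma UniformlyDetectableFrom.exists_injection_bound {q : Type*} [Fintype q] {k₀ : ℕ}
    {Y : ℕ → Matrix q p ℝ} {X : ℕ → Matrix p p ℝ} (h : UniformlyDetectableFrom k₀ Y X)
    {M κ c : ℝ} (hM : 1 ≤ M) (hX : ∀ k ξ, euclNorm (X k *ᵥ ξ) ≤ M * euclNorm ξ) (hκ : 0 ≤ κ)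
    (hc : 0 ≤ c) (hY : ∀ k, k₀ ≤ k → ∀ ξ, euclNorm (Y k *ᵥ ξ) ≤ c * euclNorm ξ) :
    ∃ (μ ν : ℕ) (γ g : ℝ), 0 ≤ γ ∧ γ < 1 ∧ 0 < g ∧ ∀ x u : ℕ → p → ℝ, ∀ k₁, k₀ ≤ k₁ →
      (∀ t, x (t + 1) = X (k₁ + t) *ᵥ (x t + u t)) →
      (∀ t, euclNorm (u t) ≤ κ * euclNorm (Y (k₁ + t) *ᵥ x t)) →
      ∀ t, euclNorm (x (t + μ)) ≤ γ * euclNorm (x t) +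
        g * ∑ j ∈ Finset.range (ν + 1), euclNorm (Y (k₁ + (t + j)) *ᵥ x (t + j)) := by
  obtain ⟨μ, ν, γ, σ, hμν, hγ, hγ1, hσ, hdet⟩ := h
  have hM0 : 0 ≤ M := by linarith
  set B : ℝ := M ^ (ν + 1) * κ with hB
  have hB0 : 0 ≤ B := by positivity
  set G : ℝ := (ν + 1) * (1 + c * B) with hG
  refine ⟨μ, ν, γ, M ^ μ * (G / √σ) + B + 1, hγ, hγ1, by positivity,
    fun x u k₁ hk₁ hx hu t => ?_⟩
  obtain ⟨k, hk⟩ : ∃ k, k = k₁ + t := ⟨_, rfl⟩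
  simp only [← add_assoc k₁ t, ← hk]
  replace hx : ∀ i, x (t + i + 1) = X (k + i) *ᵥ (x (t + i) + u (t + i)) := fun i => by
    rw [hx, hk, add_assoc]
  replace hu : ∀ i, euclNorm (u (t + i)) ≤ κ * euclNorm (Y (k + i) *ᵥ x (t + i)) := fun i => by
    rw [hk, add_assoc]; exact hu _
  set s := ∑ j ∈ Finset.range (ν + 1), euclNorm (Y (k + j) *ᵥ x (t + j)) with hs
  have hs0 : 0 ≤ s := Finset.sum_nonneg fun j _ => euclNorm_nonneg _
  have hrem : ∀ i, euclNorm (x (t + i) - transition X k i *ᵥ x t) ≤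
      M ^ i * κ * ∑ j ∈ Finset.range i, euclNorm (Y (k + j) *ᵥ x (t + j)) := by
    intro i
    induction i with
    | zero => simp [transition, euclNorm_zero]
    | succ i ih =>
      have e : x (t + (i + 1)) - transition X k (i + 1) *ᵥ x t =
          X (k + i) *ᵥ ((x (t + i) - transition X k i *ᵥ x t) + u (t + i)) := by
        rw [← add_assoc, hx, transition, ← mulVec_mulVec, ← mulVec_sub]
        congr 1; abel
      rw [e, Finset.sum_range_succ]
      have h1 := hX (k + i) ((x (t + i) - transition X k i *ᵥ x t) + u (t + i))
      have h2 := euclNorm_add_le (x (t + i) - transition X k i *ᵥ x t) (u (t + i))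
      have h3 := hu i
      have h4 : κ * euclNorm (Y (k + i) *ᵥ x (t + i)) ≤
          M ^ i * κ * euclNorm (Y (k + i) *ᵥ x (t + i)) := by
        have := one_le_pow₀ hM (n := i)
        have := mul_nonneg hκ (euclNorm_nonneg (Y (k + i) *ᵥ x (t + i)))
        nlinarith
      refine h1.trans ((mul_le_mul_of_nonneg_left (h2.trans (add_le_add ih (h3.trans h4))) hM0).trans
        (le_of_eq ?_))
      ring
  have hrem' : ∀ i ≤ ν + 1, euclNorm (x (t + i) - transition X k i *ᵥ x t) ≤ B * s := by
    intro i hi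
    refine (hrem i).trans ?_
    have h1 := pow_le_pow_right₀ hM hi
    have h2 : ∑ j ∈ Finset.range i, euclNorm (Y (k + j) *ᵥ x (t + j)) ≤ s :=
      Finset.sum_le_sum_of_subset_of_nonneg (Finset.range_subset_range.2 hi)
        fun _ _ _ => euclNorm_nonneg _
    exact mul_le_mul (mul_le_mul_of_nonneg_right h1 hκ) h2
      (Finset.sum_nonneg fun j _ => euclNorm_nonneg _) hB0
  have hμ := hrem' μ (by omega)
  have htri := euclNorm_add_le (transition X k μ *ᵥ x t) (x (t + μ) - transition X k μ *ᵥ x t)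
  rw [add_sub_cancel] at htri
  have hσ' : 0 < √σ := Real.sqrt_pos.2 hσ
  have hGσ : 0 ≤ M ^ μ * (G / √σ) := by positivity
  by_cases hcase : γ * euclNorm (x t) ≤ euclNorm (transition X k μ *ᵥ x t)
  · -- a state that does not shrink is bounded by the outputs
    have hd := hdet k (x t) (by omega) hcase
    have hout : ∀ i ∈ Finset.range (ν + 1),
        euclNorm (Y (k + i) *ᵥ (transition X k i *ᵥ x t)) ≤ (1 + c * B) * s := by
      intro i hi
      have h1 : Y (k + i) *ᵥ (transition X k i *ᵥ x t) =
          Y (k + i) *ᵥ x (t + i) - Y (k + i) *ᵥ (x (t + i) - transition X k i *ᵥ x t) := by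
        rw [mulVec_sub]; abel
      rw [h1]
      have h2 := euclNorm_sub_le (Y (k + i) *ᵥ x (t + i))
        (Y (k + i) *ᵥ (x (t + i) - transition X k i *ᵥ x t))
      have h3 := hY (k + i) (by omega) (x (t + i) - transition X k i *ᵥ x t)
      have h4 := mul_le_mul_of_nonneg_left (hrem' i (Finset.mem_range.1 hi).le) hc
      have h5 : euclNorm (Y (k + i) *ᵥ x (t + i)) ≤ s :=
        Finset.single_le_sum (f := fun j => euclNorm (Y (k + j) *ᵥ x (t + j)))
          (fun j _ => euclNorm_nonneg _) hi
      linarith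
    have hsum : (x t) ⬝ᵥ ((∑ i ∈ Finset.range (ν + 1),
          (transition X k i)ᵀ * (Y (k + i))ᵀ * Y (k + i) * transition X k i) *ᵥ (x t)) ≤
        (G * s) ^ 2 := by
      rw [sum_mulVec, dotProduct_sum]
      have h1 : ∀ i ∈ Finset.range (ν + 1), (x t) ⬝ᵥ (((transition X k i)ᵀ * (Y (k + i))ᵀ *
          Y (k + i) * transition X k i) *ᵥ (x t)) ≤ ((1 + c * B) * s) ^ 2 := by
        intro i hi
        have e : (x t) ⬝ᵥ (((transition X k i)ᵀ * (Y (k + i))ᵀ *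
            Y (k + i) * transition X k i) *ᵥ (x t)) =
            euclNorm (Y (k + i) *ᵥ (transition X k i *ᵥ x t)) ^ 2 := by
          rw [Matrix.mul_assoc _ (Y (k + i)), ← transpose_mul, ← mulVec_mulVec, dotProduct_mulVec,
            vecMul_transpose, ← mulVec_mulVec, euclNorm_sq]
        rw [e]
        exact pow_le_pow_left₀ (euclNorm_nonneg _) (hout i hi) 2
      refine (Finset.sum_le_sum h1).trans ?_
      rw [Finset.sum_const, Finset.card_range, nsmul_eq_mul, hG, mul_assoc, mul_pow (ν + 1 : ℝ)]
      push_cast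
      have : (1 : ℝ) ≤ ν + 1 := by linarith [(Nat.cast_nonneg ν : (0 : ℝ) ≤ ν)]
      exact mul_le_mul_of_nonneg_right (by nlinarith) (sq_nonneg _)
    have hxk : euclNorm (x t) ≤ G / √σ * s := by
      rw [div_mul_eq_mul_div, le_div_iff₀ hσ']
      refine le_of_abs_le (abs_le_of_sq_le_sq ?_ (by positivity))
      rw [mul_pow, Real.sq_sqrt hσ.le]
      linarith
    have h6 := euclNorm_transition_mulVec_le hM0 hX k μ (x t)
    have h7 := mul_le_mul_of_nonneg_left hxk (pow_nonneg hM0 μ)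
    have h8 := mul_nonneg hγ (euclNorm_nonneg (x t))
    nlinarith
  · push Not at hcase
    nlinarith

end Transition

/-! ### The measurement update of a single subsystem -/

section MeasurementUpdate

variable {p q : Type*} [Fintype p] [Fintype q]

/-- The data of one measurement update: a predicted covariance `Pb`, a measurement matrix `C` and a
weight `R`, with bounds that do not depend on the time or the subsystem. -/
structure IsBoundedUpdate (pb c rl ru : ℝ) (Pb : Matrix p p ℝ) (C : Matrix q p ℝ)
    (R : Matrix q q ℝ) : Prop where
  pb_pos : 0 < pb
  c_pos : 0 < c
  rl_pos : 0 < rl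
  rl_le_ru : rl ≤ ru
  posSemidef : Pb.PosSemidef
  quadForm_le : ∀ x, x ⬝ᵥ (Pb *ᵥ x) ≤ pb * euclNorm x ^ 2
  transpose_mulVec_le : ∀ g, euclNorm (Cᵀ *ᵥ g) ≤ c * euclNorm g
  isHermitian_R : R.IsHermitian
  le_quadForm_R : ∀ g, rl * euclNorm g ^ 2 ≤ g ⬝ᵥ (R *ᵥ g)
  quadForm_R_le : ∀ g, g ⬝ᵥ (R *ᵥ g) ≤ ru * euclNorm g ^ 2

namespace IsBoundedUpdate

variable {pb c rl ru : ℝ} {Pb : Matrix p p ℝ} {C : Matrix q p ℝ} {R : Matrix q q ℝ}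

lemma isHermitian_innovation (h : IsBoundedUpdate pb c rl ru Pb C R) :
    (C * Pb * Cᵀ + R).IsHermitian := by
  have := (h.posSemidef.mul_mul_conjTranspose_same C).isHermitian
  rw [conjTranspose_eq_transpose_of_trivial] at this
  exact this.add h.isHermitian_R

lemma quadForm_innovation (g : q → ℝ) : g ⬝ᵥ ((C * Pb * Cᵀ + R) *ᵥ g) =
    (Cᵀ *ᵥ g) ⬝ᵥ (Pb *ᵥ (Cᵀ *ᵥ g)) + g ⬝ᵥ (R *ᵥ g) := by
  rw [add_mulVec, dotProduct_add, dotProduct_mul_mul_transpose_mulVec]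

lemma transpose_quadForm_le (h : IsBoundedUpdate pb c rl ru Pb C R) (g : q → ℝ) :
    (Cᵀ *ᵥ g) ⬝ᵥ (Pb *ᵥ (Cᵀ *ᵥ g)) ≤ pb * c ^ 2 * euclNorm g ^ 2 := by
  have := h.pb_pos
  have h1 := pow_le_pow_left₀ (euclNorm_nonneg _) (h.transpose_mulVec_le g) 2
  calc _ ≤ pb * euclNorm (Cᵀ *ᵥ g) ^ 2 := h.quadForm_le _
    _ ≤ pb * (c * euclNorm g) ^ 2 := by gcongr
    _ = _ := by ring

lemma le_quadForm_innovation (h : IsBoundedUpdate pb c rl ru Pb C R) (g : q → ℝ) :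
    rl * euclNorm g ^ 2 ≤ g ⬝ᵥ ((C * Pb * Cᵀ + R) *ᵥ g) := by
  rw [quadForm_innovation]
  linarith [h.le_quadForm_R g, h.posSemidef.quadForm_nonneg (Cᵀ *ᵥ g)]

lemma quadForm_innovation_le (h : IsBoundedUpdate pb c rl ru Pb C R) (g : q → ℝ) :
    g ⬝ᵥ ((C * Pb * Cᵀ + R) *ᵥ g) ≤ (pb * c ^ 2 + ru) * euclNorm g ^ 2 := by
  rw [quadForm_innovation]
  linarith [h.quadForm_R_le g, h.transpose_quadForm_le g]

lemma posDef_innovation (h : IsBoundedUpdate pb c rl ru Pb C R) : (C * Pb * Cᵀ + R).PosDef :=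
  posDef_of_le_quadForm h.isHermitian_innovation h.rl_pos h.le_quadForm_innovation

variable [DecidableEq q]

lemma euclNorm_sq_le_innovation_inv (h : IsBoundedUpdate pb c rl ru Pb C R) (y : q → ℝ) :
    euclNorm y ^ 2 ≤ (pb * c ^ 2 + ru) * (y ⬝ᵥ ((C * Pb * Cᵀ + R)⁻¹ *ᵥ y)) := by
  have := h.pb_pos
  have := h.c_pos
  have := h.rl_pos.trans_le h.rl_le_ru
  exact h.posDef_innovation.euclNorm_sq_le_inv (by positivity) h.quadForm_innovation_le y

lemma euclNorm_gain_mulVec_le (h : IsBoundedUpdate pb c rl ru Pb C R) (y : q → ℝ) :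
    euclNorm ((Pb * Cᵀ * (C * Pb * Cᵀ + R)⁻¹) *ᵥ y) ≤ pb * c / rl * euclNorm y := by
  have hpb := h.pb_pos
  have hc := h.c_pos
  have hrl := h.rl_pos
  rw [← mulVec_mulVec, ← mulVec_mulVec]
  have h1 := h.posSemidef.euclNorm_mulVec_le hpb h.quadForm_le
    (Cᵀ *ᵥ ((C * Pb * Cᵀ + R)⁻¹ *ᵥ y))
  have h2 := h.transpose_mulVec_le ((C * Pb * Cᵀ + R)⁻¹ *ᵥ y)
  have h3 := h.posDef_innovation.mul_euclNorm_inv_mulVec_le hrl h.le_quadForm_innovation y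
  calc _ ≤ pb * (c * euclNorm ((C * Pb * Cᵀ + R)⁻¹ *ᵥ y)) := h1.trans (by gcongr)
    _ = pb * c / rl * (rl * euclNorm ((C * Pb * Cᵀ + R)⁻¹ *ᵥ y)) := by field_simp
    _ ≤ _ := by gcongr

lemma quadForm_correction (h : IsBoundedUpdate pb c rl ru Pb C R) (x : p → ℝ) :
    x ⬝ᵥ ((Pb - Pb * Cᵀ * (C * Pb * Cᵀ + R)⁻¹ * C * Pb) *ᵥ x) = x ⬝ᵥ (Pb *ᵥ x) -
      (C *ᵥ (Pb *ᵥ x)) ⬝ᵥ ((C * Pb * Cᵀ + R)⁻¹ *ᵥ (C *ᵥ (Pb *ᵥ x))) := by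
  have e : Pb * Cᵀ = (C * Pb)ᵀ := by
    rw [transpose_mul, ← conjTranspose_eq_transpose_of_trivial Pb, h.posSemidef.isHermitian.eq]
  rw [sub_mulVec, dotProduct_sub, e, Matrix.mul_assoc _ C, Matrix.mul_assoc, ← mulVec_mulVec,
    dotProduct_mulVec x (C * Pb)ᵀ, vecMul_transpose]
  simp only [mulVec_mulVec]

lemma isHermitian_correction (h : IsBoundedUpdate pb c rl ru Pb C R) :
    (Pb - Pb * Cᵀ * (C * Pb * Cᵀ + R)⁻¹ * C * Pb).IsHermitian := by
  refine h.posSemidef.isHermitian.sub ?_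
  have e : Pb * Cᵀ = (C * Pb)ᴴ := by
    rw [conjTranspose_mul, h.posSemidef.isHermitian.eq, conjTranspose_eq_transpose_of_trivial]
  rw [e, Matrix.mul_assoc _ C]
  exact isHermitian_conjTranspose_mul_mul _ h.isHermitian_innovation.inv

/-- A measurement reduces the covariance at most by a constant factor. -/
lemma mul_quadForm_le_correction (h : IsBoundedUpdate pb c rl ru Pb C R) (x : p → ℝ) :
    rl / (rl + pb * c ^ 2) * (x ⬝ᵥ (Pb *ᵥ x)) ≤
      x ⬝ᵥ ((Pb - Pb * Cᵀ * (C * Pb * Cᵀ + R)⁻¹ * C * Pb) *ᵥ x) := by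
  have hpb := h.pb_pos
  have hc := h.c_pos
  have hrl := h.rl_pos
  rw [h.quadForm_correction]
  set y := C *ᵥ (Pb *ᵥ x) with hy
  set g := (C * Pb * Cᵀ + R)⁻¹ *ᵥ y with hg
  set β := pb * c ^ 2 / (rl + pb * c ^ 2) with hβ
  have hβpos : 0 < β := by positivity
  have h1 : y ⬝ᵥ g = g ⬝ᵥ ((C * Pb * Cᵀ + R) *ᵥ g) := (h.posDef_innovation.quadForm_inv y).symm
  have h2 : y ⬝ᵥ g = (Cᵀ *ᵥ g) ⬝ᵥ (Pb *ᵥ x) := by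
    rw [hy, dotProduct_comm, dotProduct_mulVec, mulVec_transpose]
  have h3 := h.posSemidef.two_mul_dotProduct_mulVec_le hβpos (Cᵀ *ᵥ g) x
  have h4 : (Cᵀ *ᵥ g) ⬝ᵥ (Pb *ᵥ (Cᵀ *ᵥ g)) ≤ β * (y ⬝ᵥ g) := by
    rw [h1, quadForm_innovation, hβ, div_mul_eq_mul_div, le_div_iff₀ (by positivity)]
    have h5 := h.transpose_quadForm_le g
    have h6 := mul_le_mul_of_nonneg_left (h.le_quadForm_R g) (by positivity : 0 ≤ pb * c ^ 2)
    have h7 := mul_le_mul_of_nonneg_left h5 hrl.le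
    linarith
  have h8 := mul_le_mul_of_nonneg_left h4 (inv_nonneg.2 hβpos.le)
  rw [← mul_assoc, inv_mul_cancel₀ hβpos.ne', one_mul] at h8
  have h9 : rl / (rl + pb * c ^ 2) = 1 - β := by rw [hβ]; field_simp; ring
  rw [h9]
  linarith

lemma posSemidef_correction (h : IsBoundedUpdate pb c rl ru Pb C R) :
    (Pb - Pb * Cᵀ * (C * Pb * Cᵀ + R)⁻¹ * C * Pb).PosSemidef := by
  have hpb := h.pb_pos
  have hc := h.c_pos
  have hrl := h.rl_pos
  refine PosSemidef.of_dotProduct_mulVec_nonneg h.isHermitian_correction fun x => ?_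
  have h1 := h.posSemidef.quadForm_nonneg x
  simpa using (by positivity : 0 ≤ rl / (rl + pb * c ^ 2) * (x ⬝ᵥ (Pb *ᵥ x))).trans
    (h.mul_quadForm_le_correction x)

end IsBoundedUpdate

end MeasurementUpdate

/-! ### Bounds for the distributed Riccati recursion -/

/-- Uniform bounds for the matrices of the system and of the estimator, and for the solution of the
Riccati recursion. All constants are positive, so that one may divide by them. -/
structure LIS.HasBounds {s : ℕ} {n m : Fin s → ℕ} (S : LIS s n m) (E : EstimatorParams s n m)
    (M c rl ru qu pu : ℝ) : Prop where
  one_le_M : 1 ≤ M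
  c_pos : 0 < c
  rl_pos : 0 < rl
  rl_le_ru : rl ≤ ru
  qu_pos : 0 < qu
  pu_pos : 0 < pu
  norm_A_le : ∀ k, ‖S.globalA k‖ ≤ M
  norm_C_le : ∀ k, ‖S.globalC (k + 1)‖ ≤ c
  posSemidef_Q : ∀ k i, (E.Q k i).PosSemidef
  quadForm_Q_le : ∀ k i x, x ⬝ᵥ (E.Q k i *ᵥ x) ≤ qu * euclNorm x ^ 2
  isHermitian_R : ∀ k i, (E.R (k + 1) i).IsHermitian
  le_quadForm_R : ∀ k i x, rl * euclNorm x ^ 2 ≤ x ⬝ᵥ (E.R (k + 1) i *ᵥ x)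
  quadForm_R_le : ∀ k i x, x ⬝ᵥ (E.R (k + 1) i *ᵥ x) ≤ ru * euclNorm x ^ 2
  posSemidef_P₀ : ∀ i, (E.P₀ i).PosSemidef
  quadForm_P_le : ∀ k i x, x ⬝ᵥ (S.P E k i *ᵥ x) ≤ pu * euclNorm x ^ 2
  ϑ_sq : ∀ k i, E.ϑ k i ^ 2 = ((S.outNbrs (k + 1) i).card : ℝ) + 1

namespace LIS

variable {s : ℕ} {n m : Fin s → ℕ} {S : LIS s n m} {E : EstimatorParams s n m}

lemma sigma_mk_injective {d : Fin s → ℕ} (i : Fin s) :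
    Function.Injective (fun a => (⟨i, a⟩ : Σ i, Fin (d i))) := fun _ _ h => by simpa using h

lemma A_eq_submatrix (k : ℕ) (i j : Fin s) :
    S.A k i j = (S.globalA k).submatrix (fun a => ⟨i, a⟩) (fun a => ⟨j, a⟩) := rfl

lemma C_eq_submatrix (k : ℕ) (i : Fin s) :
    S.C k i = (S.globalC k).submatrix (fun a => ⟨i, a⟩) (fun a => ⟨i, a⟩) := by
  ext a b; simp [globalC, blockDiagonal'_apply]

lemma Pbar_succ (k : ℕ) (i : Fin s) : S.Pbar E (k + 1) i =
    E.ϑ k i ^ 2 • (∑ j ∈ insert i (S.inNbrs k i), S.A k i j * S.P E k j * (S.A k i j)ᵀ) +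
      E.Q k i := rfl

lemma P_succ (k : ℕ) (i : Fin s) : S.P E (k + 1) i = S.Pbar E (k + 1) i -
    S.Pbar E (k + 1) i * (S.C (k + 1) i)ᵀ * (S.C (k + 1) i * S.Pbar E (k + 1) i *
      (S.C (k + 1) i)ᵀ + E.R (k + 1) i)⁻¹ * S.C (k + 1) i * S.Pbar E (k + 1) i := rfl

lemma quadForm_Pbar_succ (k : ℕ) (i : Fin s) (x : Fin (n i) → ℝ) :
    x ⬝ᵥ (S.Pbar E (k + 1) i *ᵥ x) = E.ϑ k i ^ 2 * (∑ j ∈ insert i (S.inNbrs k i),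
      ((S.A k i j)ᵀ *ᵥ x) ⬝ᵥ (S.P E k j *ᵥ ((S.A k i j)ᵀ *ᵥ x))) + x ⬝ᵥ (E.Q k i *ᵥ x) := by
  rw [Pbar_succ, add_mulVec, dotProduct_add, smul_mulVec, dotProduct_smul, sum_mulVec,
    dotProduct_sum, smul_eq_mul]
  simp only [dotProduct_mul_mul_transpose_mulVec]

/-- An upper bound for the predicted covariances, in terms of the bounds of the data. -/
def pbarBound (s : ℕ) (M qu pu : ℝ) : ℝ := (s + 1) * (s * (pu * M ^ 2)) + qu

namespace HasBounds

variable {M c rl ru qu pu : ℝ}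

lemma pbarBound_pos (h : S.HasBounds E M c rl ru qu pu) : 0 < pbarBound s M qu pu := by
  have := h.qu_pos
  have := h.pu_pos
  unfold pbarBound
  positivity

lemma A_transpose_mulVec_le (h : S.HasBounds E M c rl ru qu pu) (k : ℕ) (i j : Fin s)
    (x : Fin (n i) → ℝ) : euclNorm ((S.A k i j)ᵀ *ᵥ x) ≤ M * euclNorm x := by
  rw [A_eq_submatrix, transpose_submatrix]
  refine (euclNorm_submatrix_mulVec_le _ (sigma_mk_injective j) (sigma_mk_injective i) x).trans ?_
  rw [← conjTranspose_eq_transpose_of_trivial, l2_opNorm_conjTranspose]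
  exact mul_le_mul_of_nonneg_right (h.norm_A_le k) (euclNorm_nonneg x)

lemma C_transpose_mulVec_le (h : S.HasBounds E M c rl ru qu pu) (k : ℕ) (i : Fin s)
    (x : Fin (m i) → ℝ) : euclNorm ((S.C (k + 1) i)ᵀ *ᵥ x) ≤ c * euclNorm x := by
  rw [C_eq_submatrix, transpose_submatrix]
  refine (euclNorm_submatrix_mulVec_le _ (sigma_mk_injective i) (sigma_mk_injective i) x).trans ?_
  rw [← conjTranspose_eq_transpose_of_trivial, l2_opNorm_conjTranspose]
  exact mul_le_mul_of_nonneg_right (h.norm_C_le k) (euclNorm_nonneg x)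

lemma one_le_ϑ_sq (h : S.HasBounds E M c rl ru qu pu) (k : ℕ) (i : Fin s) : 1 ≤ E.ϑ k i ^ 2 := by
  rw [h.ϑ_sq]; simp

lemma posSemidef_Pbar_of_P (h : S.HasBounds E M c rl ru qu pu) {k : ℕ}
    (hP : ∀ i, (S.P E k i).PosSemidef) (i : Fin s) : (S.Pbar E (k + 1) i).PosSemidef := by
  rw [Pbar_succ]
  refine PosSemidef.add (PosSemidef.smul (posSemidef_sum _ fun j _ => ?_) (sq_nonneg _))
    (h.posSemidef_Q k i)
  rw [← conjTranspose_eq_transpose_of_trivial]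
  exact (hP j).mul_mul_conjTranspose_same _

lemma quadForm_Pbar_le (h : S.HasBounds E M c rl ru qu pu) (k : ℕ) (i : Fin s)
    (x : Fin (n i) → ℝ) :
    x ⬝ᵥ (S.Pbar E (k + 1) i *ᵥ x) ≤ pbarBound s M qu pu * euclNorm x ^ 2 := by
  have hpu := h.pu_pos
  have card_le : ∀ t : Finset (Fin s), t.card ≤ s := fun t => by
    simpa using Finset.card_le_univ t
  have h1 : ∀ j ∈ insert i (S.inNbrs k i),
      ((S.A k i j)ᵀ *ᵥ x) ⬝ᵥ (S.P E k j *ᵥ ((S.A k i j)ᵀ *ᵥ x)) ≤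
        pu * M ^ 2 * euclNorm x ^ 2 := by
    intro j _
    have h2 := pow_le_pow_left₀ (euclNorm_nonneg _) (h.A_transpose_mulVec_le k i j x) 2
    calc _ ≤ pu * euclNorm ((S.A k i j)ᵀ *ᵥ x) ^ 2 := h.quadForm_P_le k j _
      _ ≤ pu * (M * euclNorm x) ^ 2 := by gcongr
      _ = _ := by ring
  have h3 := Finset.sum_le_sum h1
  rw [Finset.sum_const, nsmul_eq_mul] at h3
  have h4 : ((insert i (S.inNbrs k i)).card : ℝ) * (pu * M ^ 2 * euclNorm x ^ 2) ≤
      s * (pu * M ^ 2 * euclNorm x ^ 2) := by gcongr; exact card_le _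
  have h5 : E.ϑ k i ^ 2 ≤ s + 1 := by rw [h.ϑ_sq]; gcongr; exact card_le _
  rw [quadForm_Pbar_succ, pbarBound, add_mul]
  refine add_le_add ?_ (h.quadForm_Q_le k i x)
  calc _ ≤ E.ϑ k i ^ 2 * (s * (pu * M ^ 2 * euclNorm x ^ 2)) := by gcongr; exact h3.trans h4
    _ ≤ (s + 1) * (s * (pu * M ^ 2 * euclNorm x ^ 2)) := by gcongr
    _ = _ := by ring

lemma isBoundedUpdate_of_P (h : S.HasBounds E M c rl ru qu pu) {k : ℕ}
    (hP : ∀ i, (S.P E k i).PosSemidef) (i : Fin s) :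
    IsBoundedUpdate (pbarBound s M qu pu) c rl ru (S.Pbar E (k + 1) i) (S.C (k + 1) i)
      (E.R (k + 1) i) where
  pb_pos := h.pbarBound_pos
  c_pos := h.c_pos
  rl_pos := h.rl_pos
  rl_le_ru := h.rl_le_ru
  posSemidef := h.posSemidef_Pbar_of_P hP i
  quadForm_le := h.quadForm_Pbar_le k i
  transpose_mulVec_le := h.C_transpose_mulVec_le k i
  isHermitian_R := h.isHermitian_R k i
  le_quadForm_R := h.le_quadForm_R k i
  quadForm_R_le := h.quadForm_R_le k i

lemma posSemidef_P (h : S.HasBounds E M c rl ru qu pu) (k : ℕ) (i : Fin s) :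
    (S.P E k i).PosSemidef := by
  induction k generalizing i with
  | zero => exact h.posSemidef_P₀ i
  | succ k ih =>
    rw [P_succ]
    exact (h.isBoundedUpdate_of_P ih i).posSemidef_correction

lemma isBoundedUpdate (h : S.HasBounds E M c rl ru qu pu) (k : ℕ) (i : Fin s) :
    IsBoundedUpdate (pbarBound s M qu pu) c rl ru (S.Pbar E (k + 1) i) (S.C (k + 1) i)
      (E.R (k + 1) i) :=
  h.isBoundedUpdate_of_P (h.posSemidef_P k) i

/-- One step of the comparison of the predicted covariance with the reachability Gramian:
all neighbours but the subsystem itself are dropped, and the measurement update costs a constant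
factor. -/
lemma quadForm_Pbar_succ_ge (h : S.HasBounds E M c rl ru qu pu) (k : ℕ) (i : Fin s)
    (x : Fin (n i) → ℝ) :
    rl / (rl + pbarBound s M qu pu * c ^ 2) *
        (((S.A (k + 1) i i)ᵀ *ᵥ x) ⬝ᵥ (S.Pbar E (k + 1) i *ᵥ ((S.A (k + 1) i i)ᵀ *ᵥ x))) +
      x ⬝ᵥ (E.Q (k + 1) i *ᵥ x) ≤ x ⬝ᵥ (S.Pbar E (k + 2) i *ᵥ x) := by
  have h1 := (h.isBoundedUpdate k i).mul_quadForm_le_correction ((S.A (k + 1) i i)ᵀ *ᵥ x)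
  rw [← P_succ] at h1
  rw [quadForm_Pbar_succ (k + 1)]
  have h2 := Finset.single_le_sum (s := insert i (S.inNbrs (k + 1) i)) (f := fun j =>
    ((S.A (k + 1) i j)ᵀ *ᵥ x) ⬝ᵥ (S.P E (k + 1) j *ᵥ ((S.A (k + 1) i j)ᵀ *ᵥ x)))
    (fun j _ => (h.posSemidef_P (k + 1) j).quadForm_nonneg _) (Finset.mem_insert_self i _)
  have h3 := h.one_le_ϑ_sq (k + 1) i
  have h4 := (h.posSemidef_P (k + 1) i).quadForm_nonneg ((S.A (k + 1) i i)ᵀ *ᵥ x)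
  nlinarith

lemma quadForm_Pbar_ge_gramian (h : S.HasBounds E M c rl ru qu pu) (i : Fin s) (k j : ℕ)
    (x : Fin (n i) → ℝ) :
    (rl / (rl + pbarBound s M qu pu * c ^ 2)) ^ j * ∑ l ∈ Finset.range (j + 1),
      ((transition (fun k => S.A k i i) (k + l + 1) (j - l))ᵀ *ᵥ x) ⬝ᵥ (E.Q (k + l) i *ᵥ
        ((transition (fun k => S.A k i i) (k + l + 1) (j - l))ᵀ *ᵥ x)) ≤
      x ⬝ᵥ (S.Pbar E (k + j + 1) i *ᵥ x) := by
  have hp := h.pbarBound_pos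
  have hc := h.c_pos
  have hr := h.rl_pos
  set α := rl / (rl + pbarBound s M qu pu * c ^ 2) with hα
  have hα0 : 0 ≤ α := by positivity
  have hα1 : α ≤ 1 := by
    rw [hα, div_le_one (by positivity)]
    have : 0 ≤ pbarBound s M qu pu * c ^ 2 := by positivity
    linarith
  induction j generalizing x with
  | zero =>
    have h1 : 0 ≤ E.ϑ k i ^ 2 * (∑ j ∈ insert i (S.inNbrs k i),
        ((S.A k i j)ᵀ *ᵥ x) ⬝ᵥ (S.P E k j *ᵥ ((S.A k i j)ᵀ *ᵥ x))) :=
      mul_nonneg (sq_nonneg _)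
        (Finset.sum_nonneg fun j _ => (h.posSemidef_P k j).quadForm_nonneg _)
    simpa [transition, quadForm_Pbar_succ] using h1
  | succ j ih =>
    have h1 := h.quadForm_Pbar_succ_ge (k + j) i x
    have h2 := mul_le_mul_of_nonneg_left (ih ((S.A (k + j + 1) i i)ᵀ *ᵥ x)) hα0
    rw [Finset.sum_range_succ]
    have h3 : ∀ l ∈ Finset.range (j + 1),
        (transition (fun k => S.A k i i) (k + l + 1) (j + 1 - l))ᵀ *ᵥ x =
        (transition (fun k => S.A k i i) (k + l + 1) (j - l))ᵀ *ᵥ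
          ((S.A (k + j + 1) i i)ᵀ *ᵥ x) := by
      intro l hl
      have hl' : l ≤ j := Nat.lt_succ_iff.1 (Finset.mem_range.1 hl)
      rw [Nat.succ_sub hl', transition, transpose_mul, mulVec_mulVec,
        show k + l + 1 + (j - l) = k + j + 1 by omega]
    have h4 := Finset.sum_congr (rfl : Finset.range (j + 1) = _) fun l hl =>
      congrArg (fun z => z ⬝ᵥ (E.Q (k + l) i *ᵥ z)) (h3 l hl)
    rw [h4, mul_add, pow_succ', mul_assoc α]
    have h5 := (h.posSemidef_Q (k + (j + 1)) i).quadForm_nonneg x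
    have h6 : α * α ^ j * (x ⬝ᵥ (E.Q (k + (j + 1)) i *ᵥ x)) ≤ x ⬝ᵥ (E.Q (k + (j + 1)) i *ᵥ x) :=
      mul_le_of_le_one_left h5 (mul_le_one₀ hα1 (pow_nonneg hα0 j) (pow_le_one₀ hα0 hα1))
    simp only [Nat.sub_self, transition, transpose_one, one_mulVec]
    rw [show k + (j + 1) + 1 = k + j + 2 by ring]
    rw [show k + (j + 1) = k + j + 1 by ring] at h6 ⊢
    linarith

/-- Local uniform reachability keeps the predicted covariances uniformly positive definite. -/
lemma exists_le_quadForm_Pbar (h : S.HasBounds E M c rl ru qu pu) (i : Fin s)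
    (hreach : UniformlyReachable (fun k => S.A k i i) (fun k => CFC.sqrt (E.Q k i))) :
    ∃ (t : ℕ) (pl : ℝ), 0 < pl ∧ ∀ k, t ≤ k → ∀ x,
      pl * euclNorm x ^ 2 ≤ x ⬝ᵥ (S.Pbar E (k + 1) i *ᵥ x) := by
  obtain ⟨t, r, hr, hg⟩ := hreach
  have hp := h.pbarBound_pos
  have hc := h.c_pos
  have hrl := h.rl_pos
  refine ⟨t, (rl / (rl + pbarBound s M qu pu * c ^ 2)) ^ t * r, by positivity, fun k hk x => ?_⟩
  obtain ⟨k, rfl⟩ := Nat.exists_eq_add_of_le' hk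
  refine le_trans ?_ (h.quadForm_Pbar_ge_gramian i k t x)
  rw [mul_assoc]
  refine mul_le_mul_of_nonneg_left ?_ (by positivity)
  have h1 := quadForm_le_of_le (hg k) x
  rw [quadForm_smul_one, sum_mulVec, dotProduct_sum] at h1
  refine h1.trans (le_of_eq (Finset.sum_congr rfl fun l _ => ?_))
  have hQ : 0 ≤ E.Q (k + l) i := nonneg_iff_posSemidef.2 (h.posSemidef_Q _ _)
  have h2 : (CFC.sqrt (E.Q (k + l) i))ᵀ = CFC.sqrt (E.Q (k + l) i) := by
    rw [← conjTranspose_eq_transpose_of_trivial]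
    exact (nonneg_iff_posSemidef.1 (CFC.sqrt_nonneg (E.Q (k + l) i))).isHermitian.eq
  beta_reduce
  rw [← dotProduct_mul_mul_transpose_mulVec, h2,
    Matrix.mul_assoc (transition _ _ _) (CFC.sqrt (E.Q (k + l) i)),
    CFC.sqrt_mul_sqrt_self _ hQ]

end HasBounds

end LIS

/-! ### Stacked vectors -/

namespace LIS

variable {s : ℕ} {n m : Fin s → ℕ} {S : LIS s n m} {E : EstimatorParams s n m}

lemma euclNorm_stack_sq {d : Fin s → ℕ} (v : BlockVec d) :
    euclNorm (stack v) ^ 2 = ∑ i, euclNorm (v i) ^ 2 := by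
  simp only [euclNorm_sq, dotProduct, Fintype.sum_sigma, stack]

lemma euclNorm_stack_le_of_forall {d d' : Fin s → ℕ} {v : BlockVec d} {w : BlockVec d'} {κ : ℝ}
    (hκ : 0 ≤ κ) (h : ∀ i, euclNorm (v i) ≤ κ * euclNorm (w i)) :
    euclNorm (stack v) ≤ κ * euclNorm (stack w) := by
  refine le_of_abs_le (abs_le_of_sq_le_sq ?_ (mul_nonneg hκ (euclNorm_nonneg _)))
  rw [mul_pow, euclNorm_stack_sq, euclNorm_stack_sq, Finset.mul_sum]
  refine Finset.sum_le_sum fun i _ => ?_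
  rw [← mul_pow]
  exact pow_le_pow_left₀ (euclNorm_nonneg _) (h i) 2

lemma blockDiagonal'_mulVec_stack {d d' : Fin s → ℕ}
    (B : ∀ i, Matrix (Fin (d' i)) (Fin (d i)) ℝ) (v : BlockVec d) :
    blockDiagonal' B *ᵥ stack v = stack fun i => B i *ᵥ v i := by
  ext ⟨i, a⟩
  simp only [mulVec, dotProduct, Fintype.sum_sigma, stack]
  rw [Finset.sum_eq_single i (fun j _ hj => ?_) (by simp)]
  · simp [blockDiagonal'_apply]
  · simp [blockDiagonal'_apply, hj.symm]

lemma stack_propagate (k : ℕ) (x : BlockVec n) :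
    stack (S.propagate k x) = S.globalA k *ᵥ stack x := by
  ext ⟨i, a⟩
  simp only [propagate, stack, mulVec, dotProduct, Fintype.sum_sigma, Finset.sum_apply, globalA,
    of_apply]
  refine Finset.sum_subset (Finset.subset_univ _) fun j _ hj => ?_
  have hA : S.A k i j = 0 := by
    simp only [inNbrs, Finset.mem_insert, Finset.mem_filter, Finset.mem_univ, true_and] at hj
    tauto
  simp [hA]

variable (S E) in
/-- The stacked estimator gain. -/
noncomputable def globalGain (k : ℕ) : Matrix (Σ i : Fin s, Fin (n i)) (Σ i : Fin s, Fin (m i)) ℝ :=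
  blockDiagonal' (S.gain E k)

variable (S E) in
/-- The matrix that drives the stacked estimation error in the absence of noise. -/
noncomputable def closedLoop (k : ℕ) : Matrix (Σ i : Fin s, Fin (n i)) (Σ i : Fin s, Fin (n i)) ℝ :=
  (1 - S.globalGain E (k + 1) * S.globalC (k + 1)) * S.globalA k

lemma closedLoop_mulVec (k : ℕ) (ξ : (Σ i : Fin s, Fin (n i)) → ℝ) :
    S.closedLoop E k *ᵥ ξ = S.globalA k *ᵥ ξ -
      S.globalGain E (k + 1) *ᵥ (S.globalC (k + 1) *ᵥ (S.globalA k *ᵥ ξ)) := by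
  simp only [closedLoop, ← mulVec_mulVec, sub_mulVec, one_mulVec]

lemma stack_estError_succ (x₀ xh₀ : BlockVec n) (w : ℕ → BlockVec n) (v : ℕ → BlockVec m)
    (k : ℕ) :
    stack (S.estError E x₀ xh₀ w v (k + 1)) =
      S.closedLoop E k *ᵥ stack (S.estError E x₀ xh₀ w v k) +
        (stack (w k) - S.globalGain E (k + 1) *ᵥ
          (S.globalC (k + 1) *ᵥ stack (w k) + stack (v (k + 1)))) := by
  have hsub : stack (S.estError E x₀ xh₀ w v k) = stack (S.state x₀ w k) -
      stack (S.estimate E xh₀ (S.measurement (S.state x₀ w) v) k) := rfl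
  have hx : stack (S.state x₀ w (k + 1)) =
      S.globalA k *ᵥ stack (S.state x₀ w k) + stack (w k) := by
    rw [← stack_propagate]; rfl
  have hxh : stack (S.estimate E xh₀ (S.measurement (S.state x₀ w) v) (k + 1)) =
      S.globalA k *ᵥ stack (S.estimate E xh₀ (S.measurement (S.state x₀ w) v) k) +
        S.globalGain E (k + 1) *ᵥ (S.globalC (k + 1) *ᵥ stack (S.state x₀ w (k + 1)) +
          stack (v (k + 1)) - S.globalC (k + 1) *ᵥ (S.globalA k *ᵥ
            stack (S.estimate E xh₀ (S.measurement (S.state x₀ w) v) k))) := by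
    rw [← stack_propagate, globalC, blockDiagonal'_mulVec_stack, blockDiagonal'_mulVec_stack]
    have h1 := blockDiagonal'_mulVec_stack (S.gain E (k + 1)) fun i =>
      S.measurement (S.state x₀ w) v (k + 1) i - S.C (k + 1) i *ᵥ
        S.propagate k (S.estimate E xh₀ (S.measurement (S.state x₀ w) v) k) i
    exact congrArg (stack (S.propagate k _) + ·) h1.symm
  have h1 : stack (S.estError E x₀ xh₀ w v (k + 1)) = stack (S.state x₀ w (k + 1)) -
      stack (S.estimate E xh₀ (S.measurement (S.state x₀ w) v) (k + 1)) := rfl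
  rw [h1, hxh, hx, hsub, closedLoop_mulVec]
  simp only [mulVec_add, mulVec_sub]
  abel

/-! ### The weighted energy of the prediction error -/

variable (S E) in
/-- The energy of the prediction error `x` at time `k`. The weight `|𝕆_i(k)| + 1` counts the
subsystems that receive the state of subsystem `i` in the next step; it equals `ϑ_i(k-1)²`. -/
noncomputable def energy (k : ℕ) (x : BlockVec n) : ℝ :=
  ∑ i, (((S.outNbrs k i).card : ℝ) + 1) * (x i ⬝ᵥ ((S.Pbar E k i)⁻¹ *ᵥ x i))

lemma mem_insert_inNbrs_iff (k : ℕ) (i j : Fin s) :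
    j ∈ insert i (S.inNbrs k i) ↔ i ∈ insert j (S.outNbrs k j) := by
  simp only [inNbrs, outNbrs, Finset.mem_insert, Finset.mem_filter, Finset.mem_univ, true_and]
  tauto

lemma card_insert_outNbrs (k : ℕ) (i : Fin s) :
    (insert i (S.outNbrs k i)).card = (S.outNbrs k i).card + 1 :=
  Finset.card_insert_of_notMem (by simp [outNbrs])

namespace HasBounds

variable {M c rl ru qu pu : ℝ}

/-- The measurement update in the coordinates `f = P̄⁻¹ x`: the corrected error is `P f`, and its
energy is that of `x` less the energy of the innovation. -/
lemma P_mulVec_inv_Pbar_mulVec {k : ℕ} {i : Fin s} (hpd : (S.Pbar E (k + 1) i).PosDef)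
    (x : Fin (n i) → ℝ) : S.P E (k + 1) i *ᵥ ((S.Pbar E (k + 1) i)⁻¹ *ᵥ x) =
      x - S.gain E (k + 1) i *ᵥ (S.C (k + 1) i *ᵥ x) := by
  rw [P_succ, sub_mulVec, ← mulVec_mulVec _ _ (S.Pbar E (k + 1) i), hpd.mulVec_inv_mulVec,
    ← mulVec_mulVec, gain]

lemma quadForm_P_inv_Pbar_mulVec (h : S.HasBounds E M c rl ru qu pu) {k : ℕ} {i : Fin s}
    (hpd : (S.Pbar E (k + 1) i).PosDef) (x : Fin (n i) → ℝ) :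
    ((S.Pbar E (k + 1) i)⁻¹ *ᵥ x) ⬝ᵥ (S.P E (k + 1) i *ᵥ ((S.Pbar E (k + 1) i)⁻¹ *ᵥ x)) +
      (pbarBound s M qu pu * c ^ 2 + ru)⁻¹ * euclNorm (S.C (k + 1) i *ᵥ x) ^ 2 ≤
      x ⬝ᵥ ((S.Pbar E (k + 1) i)⁻¹ *ᵥ x) := by
  have hp := h.pbarBound_pos
  have hc := h.c_pos
  have hr := h.rl_pos.trans_le h.rl_le_ru
  rw [P_succ, (h.isBoundedUpdate k i).quadForm_correction, hpd.quadForm_inv, hpd.mulVec_inv_mulVec]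
  have h1 := mul_le_mul_of_nonneg_left
    ((h.isBoundedUpdate k i).euclNorm_sq_le_innovation_inv (S.C (k + 1) i *ᵥ x))
    (by positivity : 0 ≤ (pbarBound s M qu pu * c ^ 2 + ru)⁻¹)
  rw [← mul_assoc, inv_mul_cancel₀ (by positivity), one_mul] at h1
  linarith

/-- The prediction step of one subsystem: the energy of a sum over the neighbours is controlled by
the sum of their energies. -/
lemma ϑ_sq_mul_quadForm_inv_le (h : S.HasBounds E M c rl ru qu pu) {k : ℕ} {i : Fin s}
    (hpd : (S.Pbar E (k + 1) i).PosDef) (f : BlockVec n) :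
    E.ϑ k i ^ 2 * (S.propagate k (fun j => S.P E k j *ᵥ f j) i ⬝ᵥ ((S.Pbar E (k + 1) i)⁻¹ *ᵥ
      S.propagate k (fun j => S.P E k j *ᵥ f j) i)) ≤
      ∑ j ∈ insert i (S.inNbrs k i), f j ⬝ᵥ (S.P E k j *ᵥ f j) := by
  set x := S.propagate k (fun j => S.P E k j *ᵥ f j) i with hx
  set g := (S.Pbar E (k + 1) i)⁻¹ *ᵥ x with hg
  have hϑ : 0 < E.ϑ k i ^ 2 := one_pos.trans_le (h.one_le_ϑ_sq k i)
  have h1 : x ⬝ᵥ g = E.ϑ k i ^ 2 * (∑ j ∈ insert i (S.inNbrs k i),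
      ((S.A k i j)ᵀ *ᵥ g) ⬝ᵥ (S.P E k j *ᵥ ((S.A k i j)ᵀ *ᵥ g))) + g ⬝ᵥ (E.Q k i *ᵥ g) := by
    rw [← quadForm_Pbar_succ, hg, hpd.quadForm_inv]
  have h2 : x ⬝ᵥ g =
      ∑ j ∈ insert i (S.inNbrs k i), ((S.A k i j)ᵀ *ᵥ g) ⬝ᵥ (S.P E k j *ᵥ f j) := by
    rw [dotProduct_comm, hx, propagate, dotProduct_sum]
    refine Finset.sum_congr rfl fun j _ => ?_
    rw [dotProduct_mulVec, mulVec_transpose]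
  have h3 := Finset.sum_le_sum fun j (_ : j ∈ insert i (S.inNbrs k i)) =>
    (h.posSemidef_P k j).two_mul_dotProduct_mulVec_le (inv_pos.2 hϑ) ((S.A k i j)ᵀ *ᵥ g) (f j)
  rw [← Finset.mul_sum, ← h2, Finset.sum_add_distrib, ← Finset.mul_sum, ← Finset.mul_sum,
    inv_inv] at h3
  have h4 := (h.posSemidef_Q k i).quadForm_nonneg g
  have h5 : x ⬝ᵥ g ≤ (E.ϑ k i ^ 2)⁻¹ * ∑ j ∈ insert i (S.inNbrs k i), f j ⬝ᵥ (S.P E k j *ᵥ f j) := by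
    linarith
  have h6 := mul_le_mul_of_nonneg_left h5 hϑ.le
  rwa [← mul_assoc, mul_inv_cancel₀ hϑ.ne', one_mul] at h6

/-- The energy is dissipated by the output. Summing the prediction step over all subsystems counts
the energy of subsystem `j` once for each receiver of its state, which is what the weights record. -/
lemma energy_succ_le (h : S.HasBounds E M c rl ru qu pu) {k : ℕ}
    (hpd : ∀ i, (S.Pbar E (k + 1) i).PosDef) (hpd' : ∀ i, (S.Pbar E (k + 2) i).PosDef)
    (x : BlockVec n) :
    S.energy E (k + 2) (S.propagate (k + 1)
      (fun j => x j - S.gain E (k + 1) j *ᵥ (S.C (k + 1) j *ᵥ x j))) ≤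
      S.energy E (k + 1) x - (pbarBound s M qu pu * c ^ 2 + ru)⁻¹ *
        euclNorm (S.globalC (k + 1) *ᵥ stack x) ^ 2 := by
  have hp := h.pbarBound_pos
  have hc := h.c_pos
  have hr := h.rl_pos.trans_le h.rl_le_ru
  set σ := (pbarBound s M qu pu * c ^ 2 + ru)⁻¹ with hσ
  have hσ0 : 0 ≤ σ := by positivity
  set f : BlockVec n := fun j => (S.Pbar E (k + 1) j)⁻¹ *ᵥ x j with hf
  have e : (fun j => x j - S.gain E (k + 1) j *ᵥ (S.C (k + 1) j *ᵥ x j)) =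
      fun j => S.P E (k + 1) j *ᵥ f j :=
    funext fun j => (P_mulVec_inv_Pbar_mulVec (hpd j) (x j)).symm
  rw [e]
  calc _ ≤ ∑ i, ∑ j ∈ insert i (S.inNbrs (k + 1) i), f j ⬝ᵥ (S.P E (k + 1) j *ᵥ f j) := by
        refine Finset.sum_le_sum fun i _ => ?_
        rw [← h.ϑ_sq (k + 1) i]
        exact h.ϑ_sq_mul_quadForm_inv_le (hpd' i) f
    _ = ∑ j, ∑ i ∈ insert j (S.outNbrs (k + 1) j), f j ⬝ᵥ (S.P E (k + 1) j *ᵥ f j) :=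
        Finset.sum_comm' fun i j => by simp [-Finset.mem_insert, mem_insert_inNbrs_iff]
    _ = ∑ j, (((S.outNbrs (k + 1) j).card : ℝ) + 1) * (f j ⬝ᵥ (S.P E (k + 1) j *ᵥ f j)) := by
        refine Finset.sum_congr rfl fun j _ => ?_
        rw [Finset.sum_const, card_insert_outNbrs, nsmul_eq_mul]
        push_cast
        rfl
    _ ≤ ∑ j, ((((S.outNbrs (k + 1) j).card : ℝ) + 1) *
          (x j ⬝ᵥ ((S.Pbar E (k + 1) j)⁻¹ *ᵥ x j)) -
            σ * euclNorm (S.C (k + 1) j *ᵥ x j) ^ 2) := by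
        refine Finset.sum_le_sum fun j _ => ?_
        have h1 := h.quadForm_P_inv_Pbar_mulVec (hpd j) (x j)
        have h2 : (0 : ℝ) ≤ (S.outNbrs (k + 1) j).card := Nat.cast_nonneg _
        have h3 := mul_le_mul_of_nonneg_left h1 (by positivity :
          (0 : ℝ) ≤ ((S.outNbrs (k + 1) j).card : ℝ) + 1)
        have h4 : 0 ≤ ((S.outNbrs (k + 1) j).card : ℝ) *
          (σ * euclNorm (S.C (k + 1) j *ᵥ x j) ^ 2) := by positivity
        linarith
    _ = _ := by
        rw [Finset.sum_sub_distrib, ← Finset.mul_sum, globalC, blockDiagonal'_mulVec_stack,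
          euclNorm_stack_sq, energy]

lemma le_energy (h : S.HasBounds E M c rl ru qu pu) {k : ℕ}
    (hpd : ∀ i, (S.Pbar E (k + 1) i).PosDef) (x : BlockVec n) :
    (pbarBound s M qu pu)⁻¹ * euclNorm (stack x) ^ 2 ≤ S.energy E (k + 1) x := by
  have hp := h.pbarBound_pos
  rw [euclNorm_stack_sq, Finset.mul_sum]
  refine Finset.sum_le_sum fun i _ => ?_
  have h1 := (hpd i).euclNorm_sq_le_inv hp (h.quadForm_Pbar_le k i) (x i)
  have h2 := mul_le_mul_of_nonneg_left h1 (inv_nonneg.2 hp.le)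
  rw [← mul_assoc, inv_mul_cancel₀ hp.ne', one_mul] at h2
  have h3 : 0 ≤ ((S.outNbrs (k + 1) i).card : ℝ) * (x i ⬝ᵥ ((S.Pbar E (k + 1) i)⁻¹ *ᵥ x i)) :=
    mul_nonneg (Nat.cast_nonneg _) ((hpd i).inv.posSemidef.quadForm_nonneg _)
  linarith

lemma energy_le {k : ℕ} {pl : ℝ} (hpl : 0 < pl) (hpd : ∀ i, (S.Pbar E (k + 1) i).PosDef)
    (hge : ∀ i x, pl * euclNorm x ^ 2 ≤ x ⬝ᵥ (S.Pbar E (k + 1) i *ᵥ x)) (x : BlockVec n) :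
    S.energy E (k + 1) x ≤ (s + 1) / pl * euclNorm (stack x) ^ 2 := by
  rw [euclNorm_stack_sq, Finset.mul_sum]
  refine Finset.sum_le_sum fun i _ => ?_
  have h1 := (hpd i).mul_quadForm_inv_le hpl (hge i) (x i)
  have h2 : ((S.outNbrs (k + 1) i).card : ℝ) ≤ s := by
    exact_mod_cast (by simpa using Finset.card_le_univ (S.outNbrs (k + 1) i))
  have h3 := (hpd i).inv.posSemidef.quadForm_nonneg (x i)
  rw [div_mul_eq_mul_div, le_div_iff₀ hpl]
  calc _ = (((S.outNbrs (k + 1) i).card : ℝ) + 1) *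
        (pl * (x i ⬝ᵥ ((S.Pbar E (k + 1) i)⁻¹ *ᵥ x i))) := by ring
    _ ≤ (s + 1) * euclNorm (x i) ^ 2 := by gcongr

/-! ### Exponential stability of the estimation error -/

lemma euclNorm_globalA_mulVec_le (h : S.HasBounds E M c rl ru qu pu) (k : ℕ)
    (ξ : (Σ i : Fin s, Fin (n i)) → ℝ) : euclNorm (S.globalA k *ᵥ ξ) ≤ M * euclNorm ξ :=
  (euclNorm_mulVec_le _ _).trans
    (mul_le_mul_of_nonneg_right (h.norm_A_le k) (euclNorm_nonneg _))

lemma euclNorm_globalC_mulVec_le (h : S.HasBounds E M c rl ru qu pu) (k : ℕ)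
    (ξ : (Σ i : Fin s, Fin (n i)) → ℝ) : euclNorm (S.globalC (k + 1) *ᵥ ξ) ≤ c * euclNorm ξ :=
  (euclNorm_mulVec_le _ _).trans
    (mul_le_mul_of_nonneg_right (h.norm_C_le k) (euclNorm_nonneg _))

lemma gainBound_nonneg (h : S.HasBounds E M c rl ru qu pu) :
    0 ≤ pbarBound s M qu pu * c / rl := by
  have := h.pbarBound_pos
  have := h.c_pos
  have := h.rl_pos
  positivity

lemma euclNorm_globalGain_mulVec_le (h : S.HasBounds E M c rl ru qu pu) (k : ℕ)
    (y : BlockVec m) : euclNorm (S.globalGain E (k + 1) *ᵥ stack y) ≤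
      pbarBound s M qu pu * c / rl * euclNorm (stack y) := by
  rw [globalGain, blockDiagonal'_mulVec_stack]
  exact euclNorm_stack_le_of_forall h.gainBound_nonneg
    fun i => (h.isBoundedUpdate k i).euclNorm_gain_mulVec_le (y i)

lemma euclNorm_sub_gain_mulVec_le (h : S.HasBounds E M c rl ru qu pu) (k : ℕ)
    (ξ : (Σ i : Fin s, Fin (n i)) → ℝ) :
    euclNorm (ξ - S.globalGain E (k + 1) *ᵥ (S.globalC (k + 1) *ᵥ ξ)) ≤
      (1 + pbarBound s M qu pu * c / rl * c) * euclNorm ξ := by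
  have h1 := euclNorm_sub_le ξ (S.globalGain E (k + 1) *ᵥ (S.globalC (k + 1) *ᵥ ξ))
  have h2 := h.euclNorm_globalGain_mulVec_le k fun i a => (S.globalC (k + 1) *ᵥ ξ) ⟨i, a⟩
  have h3 := mul_le_mul_of_nonneg_left (h.euclNorm_globalC_mulVec_le k ξ) h.gainBound_nonneg
  change euclNorm (S.globalGain E (k + 1) *ᵥ (S.globalC (k + 1) *ᵥ ξ)) ≤
    pbarBound s M qu pu * c / rl * euclNorm (S.globalC (k + 1) *ᵥ ξ) at h2
  linarith

lemma euclNorm_closedLoop_mulVec_le (h : S.HasBounds E M c rl ru qu pu) (k : ℕ)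
    (ξ : (Σ i : Fin s, Fin (n i)) → ℝ) : euclNorm (S.closedLoop E k *ᵥ ξ) ≤
      (1 + pbarBound s M qu pu * c / rl * c) * M * euclNorm ξ := by
  have h0 := h.gainBound_nonneg
  have hc := h.c_pos
  rw [closedLoop_mulVec, mul_assoc]
  exact (h.euclNorm_sub_gain_mulVec_le k _).trans
    (mul_le_mul_of_nonneg_left (h.euclNorm_globalA_mulVec_le k ξ) (by positivity))

/-- Exponential stability from a time on at which the predicted covariances are uniformly positive
definite. -/
lemma exists_closedLoop_bound_of_le (h : S.HasBounds E M c rl ru qu pu)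
    (hdet : UniformlyDetectableFrom 1 S.globalC S.globalA) {k₁ : ℕ} {pl : ℝ} (hpl : 0 < pl)
    (hge : ∀ k, k₁ ≤ k → ∀ i x, pl * euclNorm x ^ 2 ≤ x ⬝ᵥ (S.Pbar E (k + 1) i *ᵥ x)) :
    ∃ a b : ℝ, 0 ≤ a ∧ 0 < b ∧ b < 1 ∧ ∀ k, k₁ ≤ k → ∀ t ξ,
      euclNorm (transition (S.closedLoop E) k t *ᵥ ξ) ≤ a * b ^ t * euclNorm ξ := by
  have hp := h.pbarBound_pos
  have hc := h.c_pos
  have hr := h.rl_pos.trans_le h.rl_le_ru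
  have hM := h.one_le_M
  set κ := pbarBound s M qu pu * c / rl with hκ
  have hκ0 : 0 ≤ κ := h.gainBound_nonneg
  obtain ⟨μ, ν, γ, g, hγ, hγ1, hg, hinj⟩ := hdet.exists_injection_bound h.one_le_M
    h.euclNorm_globalA_mulVec_le hκ0 hc.le fun k hk ξ => by
      obtain ⟨k, rfl⟩ := Nat.exists_eq_add_of_le' hk
      exact h.euclNorm_globalC_mulVec_le k ξ
  obtain ⟨a, b, ha, hb, hb1, hdecay⟩ := exists_geometric_decay
    (c₁ := (pbarBound s M qu pu)⁻¹) (c₂ := (s + 1) / pl)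
    (c := (pbarBound s M qu pu * c ^ 2 + ru)⁻¹) μ ν (by positivity) (by positivity) (by positivity)
    hg hγ hγ1
  refine ⟨1 + (1 + κ * c) * a * M / b, b, by positivity, hb, hb1, fun k hk t ξ => ?_⟩
  have hpd : ∀ t i, (S.Pbar E (k + t + 1) i).PosDef := fun t i =>
    posDef_of_le_quadForm (h.isBoundedUpdate _ i).posSemidef.isHermitian hpl
      (hge (k + t) (by omega) i)
  -- `x t` is the prediction error at time `k + t + 1`
  set x : ℕ → (Σ i : Fin s, Fin (n i)) → ℝ :=
    fun t => S.globalA (k + t) *ᵥ (transition (S.closedLoop E) k t *ᵥ ξ) with hx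
  set u : ℕ → (Σ i : Fin s, Fin (n i)) → ℝ :=
    fun t => -(S.globalGain E (k + 1 + t) *ᵥ (S.globalC (k + 1 + t) *ᵥ x t)) with hu
  have hsucc : ∀ t, transition (S.closedLoop E) k (t + 1) *ᵥ ξ = x t + u t := fun t => by
    rw [transition, ← mulVec_mulVec, closedLoop_mulVec, sub_eq_add_neg]
    simp only [hx, hu, show k + 1 + t = k + t + 1 by ring]
  have hxs : ∀ t, x (t + 1) = S.globalA (k + 1 + t) *ᵥ (x t + u t) := fun t => by
    rw [← hsucc, show k + 1 + t = k + (t + 1) by ring]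
  have hus : ∀ t, euclNorm (u t) ≤ κ * euclNorm (S.globalC (k + 1 + t) *ᵥ x t) := fun t => by
    simp only [hu, euclNorm_neg, show k + 1 + t = k + t + 1 by ring]
    exact h.euclNorm_globalGain_mulVec_le (k + t)
      fun i a => (S.globalC (k + t + 1) *ᵥ x t) ⟨i, a⟩
  have hbound := hdecay (fun t => euclNorm (x t))
    (fun t => euclNorm (S.globalC (k + 1 + t) *ᵥ x t))
    (fun t => S.energy E (k + t + 1) fun i a => x t ⟨i, a⟩)
    (fun t => euclNorm_nonneg _) (fun t => euclNorm_nonneg _)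
    (fun t => h.le_energy (hpd t) fun i a => x t ⟨i, a⟩)
    (fun t => energy_le hpl (hpd t) (hge (k + t) (by omega)) fun i a => x t ⟨i, a⟩)
    (fun t => by
      have h1 := h.energy_succ_le (hpd t) (hpd (t + 1)) fun i a => x t ⟨i, a⟩
      have h2 : stack (S.propagate (k + t + 1) fun j => (fun a => x t ⟨j, a⟩) -
          S.gain E (k + t + 1) j *ᵥ (S.C (k + t + 1) j *ᵥ fun a => x t ⟨j, a⟩)) = x (t + 1) := by
        rw [stack_propagate, hxs, show k + 1 + t = k + t + 1 by ring]
        congr 1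
        have h3 : x t = stack fun i a => x t ⟨i, a⟩ := rfl
        simp only [hu, show k + 1 + t = k + t + 1 by ring]
        rw [h3, globalC, globalGain, blockDiagonal'_mulVec_stack, blockDiagonal'_mulVec_stack,
          ← sub_eq_add_neg]
        rfl
      have h4 : (S.propagate (k + t + 1) fun j => (fun a => x t ⟨j, a⟩) -
          S.gain E (k + t + 1) j *ᵥ (S.C (k + t + 1) j *ᵥ fun a => x t ⟨j, a⟩)) =
          fun i a => x (t + 1) ⟨i, a⟩ := by
        rw [← h2]; rfl
      rw [h4] at h1
      simp only [show k + 1 + t = k + t + 1 by ring]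
      exact h1)
    (hinj x u (k + 1) (by omega) hxs hus)
  have hξ := euclNorm_nonneg ξ
  cases t with
  | zero =>
    have : 0 ≤ (1 + κ * c) * a * M / b := by positivity
    simp only [transition, one_mulVec, pow_zero, mul_one]
    nlinarith
  | succ t =>
    have h1 : euclNorm (x t + u t) ≤ (1 + κ * c) * euclNorm (x t) := by
      simp only [hu, ← sub_eq_add_neg, show k + 1 + t = k + t + 1 by ring]
      exact h.euclNorm_sub_gain_mulVec_le (k + t) (x t)
    have h2 : euclNorm (x 0) ≤ M * euclNorm ξ := by
      simpa [hx, transition] using h.euclNorm_globalA_mulVec_le k ξ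
    rw [hsucc]
    calc _ ≤ (1 + κ * c) * (a * b ^ t * (M * euclNorm ξ)) := h1.trans (by
          gcongr; exact (hbound t).trans (by gcongr))
      _ = (1 + κ * c) * a * M / b * b ^ (t + 1) * euclNorm ξ := by field_simp; ring
      _ ≤ _ := by gcongr; linarith

lemma exists_closedLoop_bound (h : S.HasBounds E M c rl ru qu pu)
    (hdet : UniformlyDetectableFrom 1 S.globalC S.globalA)
    (hreach : ∀ i, UniformlyReachable (fun k => S.A k i i) (fun k => CFC.sqrt (E.Q k i))) :
    ∃ a b : ℝ, 0 ≤ a ∧ 0 ≤ b ∧ b < 1 ∧ ∀ k t ξ,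
      euclNorm (transition (S.closedLoop E) k t *ᵥ ξ) ≤ a * b ^ t * euclNorm ξ := by
  choose t pl hpl hge using fun i => h.exists_le_quadForm_Pbar i (hreach i)
  obtain ⟨k₁, hk₁⟩ := Finite.exists_le t
  obtain ⟨B, hB⟩ := Finite.exists_le fun i => (pl i)⁻¹
  have hB' : 0 < max B 1 := lt_max_of_lt_right one_pos
  have hle : ∀ i, (max B 1)⁻¹ ≤ pl i := fun i =>
    inv_le_of_inv_le₀ (hpl i) ((hB i).trans (le_max_left _ _))
  obtain ⟨a, b, ha, hb, hb1, hab⟩ := h.exists_closedLoop_bound_of_le hdet (k₁ := k₁)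
    (inv_pos.2 hB') fun k hk i x =>
      (mul_le_mul_of_nonneg_right (hle i) (sq_nonneg _)).trans (hge i k ((hk₁ i).trans hk) x)
  have h0 := h.gainBound_nonneg
  have hc := h.c_pos
  obtain ⟨a', ha', hab'⟩ := exists_transition_bound
    (one_le_mul_of_one_le_of_one_le (by linarith [mul_nonneg h0 hc.le]) h.one_le_M)
    h.euclNorm_closedLoop_mulVec_le ha hb hb1 k₁ hab
  exact ⟨a', b, ha', hb.le, hb1, hab'⟩

lemma euclNorm_noise_le (h : S.HasBounds E M c rl ru qu pu) (k : ℕ) (w : BlockVec n)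
    (v : BlockVec m) :
    euclNorm (stack w - S.globalGain E (k + 1) *ᵥ (S.globalC (k + 1) *ᵥ stack w + stack v)) ≤
      (1 + pbarBound s M qu pu * c / rl * c) * euclNorm (stack w) +
        pbarBound s M qu pu * c / rl * euclNorm (stack v) := by
  rw [mulVec_add, ← sub_sub]
  exact (euclNorm_sub_le _ _).trans
    (add_le_add (h.euclNorm_sub_gain_mulVec_le k _) (h.euclNorm_globalGain_mulVec_le k v))

end HasBounds

lemma exists_hasBounds
    (hA : ∃ M : ℝ, ∀ k : ℕ, ‖S.globalA k‖ ≤ M)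
    (hC : ∃ M : ℝ, ∀ k : ℕ, ‖S.globalC (k + 1)‖ ≤ M)
    (hP₀ : ∀ i, 0 ≤ E.P₀ i)
    (hϑ : ∀ k i, E.ϑ k i = Real.sqrt (((S.outNbrs (k + 1) i).card : ℝ) + 1))
    (hQR : ∀ i, ∃ qu ru rl : ℝ, 0 ≤ qu ∧ 0 < rl ∧ rl ≤ ru ∧ ∀ k : ℕ,
      (0 ≤ E.Q k i ∧ E.Q k i ≤ qu • (1 : Matrix (Fin (n i)) (Fin (n i)) ℝ)) ∧
      (rl • (1 : Matrix (Fin (m i)) (Fin (m i)) ℝ) ≤ E.R (k + 1) i ∧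
        E.R (k + 1) i ≤ ru • (1 : Matrix (Fin (m i)) (Fin (m i)) ℝ)))
    (hP : ∀ i, ∃ pu : ℝ, 0 ≤ pu ∧ ∀ k : ℕ,
      S.P E k i ≤ pu • (1 : Matrix (Fin (n i)) (Fin (n i)) ℝ)) :
    ∃ M c rl ru qu pu : ℝ, S.HasBounds E M c rl ru qu pu := by
  obtain ⟨M, hM⟩ := hA
  obtain ⟨c, hc⟩ := hC
  choose qu ru rl _ hrl _ hQR using hQR
  choose pu _ hP using hP
  obtain ⟨qU, hqU⟩ := Finite.exists_le qu
  obtain ⟨rU, hrU⟩ := Finite.exists_le ru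
  obtain ⟨rI, hrI⟩ := Finite.exists_le fun i => (rl i)⁻¹
  obtain ⟨pU, hpU⟩ := Finite.exists_le pu
  have hpos : ∀ r : ℝ, 0 < max r 1 := fun r => lt_max_of_lt_right one_pos
  have hrL : ∀ i, (max rI 1)⁻¹ ≤ rl i := fun i =>
    inv_le_of_inv_le₀ (hrl i) ((hrI i).trans (le_max_left _ _))
  have hscale : ∀ {a b : ℝ} {d : ℕ} (x : Fin d → ℝ), a ≤ b →
      a * euclNorm x ^ 2 ≤ b * euclNorm x ^ 2 :=
    fun x hab => mul_le_mul_of_nonneg_right hab (sq_nonneg _)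
  refine ⟨max M 1, max c 1, (max rI 1)⁻¹, max rU 1, max qU 1, max pU 1, ?_⟩
  exact {
    one_le_M := le_max_right _ _
    c_pos := hpos _
    rl_pos := inv_pos.2 (hpos _)
    rl_le_ru := (inv_le_one_of_one_le₀ (le_max_right _ _)).trans (le_max_right _ _)
    qu_pos := hpos _
    pu_pos := hpos _
    norm_A_le := fun k => (hM k).trans (le_max_left _ _)
    norm_C_le := fun k => (hc k).trans (le_max_left _ _)
    posSemidef_Q := fun k i => nonneg_iff_posSemidef.1 (hQR i k).1.1
    quadForm_Q_le := fun k i x => by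
      have h1 := quadForm_le_of_le (hQR i k).1.2 x
      rw [quadForm_smul_one] at h1
      exact h1.trans (hscale x ((hqU i).trans (le_max_left _ _)))
    isHermitian_R := fun k i => by
      have h1 := (Matrix.le_iff.1 (hQR i k).2.1).isHermitian.add
        (PosSemidef.one.smul (hrl i).le).isHermitian
      rwa [sub_add_cancel] at h1
    le_quadForm_R := fun k i x => by
      have h1 := quadForm_le_of_le (hQR i k).2.1 x
      rw [quadForm_smul_one] at h1
      exact (hscale x (hrL i)).trans h1
    quadForm_R_le := fun k i x => by
      have h1 := quadForm_le_of_le (hQR i k).2.2 x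
      rw [quadForm_smul_one] at h1
      exact h1.trans (hscale x ((hrU i).trans (le_max_left _ _)))
    posSemidef_P₀ := fun i => nonneg_iff_posSemidef.1 (hP₀ i)
    quadForm_P_le := fun k i x => by
      have h1 := quadForm_le_of_le (hP i k) x
      rw [quadForm_smul_one] at h1
      exact h1.trans (hscale x ((hpU i).trans (le_max_left _ _)))
    ϑ_sq := fun k i => by rw [hϑ, Real.sq_sqrt (by positivity)] }

end LIS

theorem theorem1 {s : ℕ} {n m : Fin s → ℕ} (S : LIS s n m) (E : EstimatorParams s n m)
    -- standing assumptions on the interconnected system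
    (hA : ∃ M : ℝ, ∀ k : ℕ, ‖S.globalA k‖ ≤ M)
    (hC : ∃ M : ℝ, ∀ k : ℕ, ‖S.globalC (k + 1)‖ ≤ M)
    (hdet : UniformlyDetectableFrom 1 S.globalC S.globalA)
    -- initial value of the Riccati recursion
    (hP₀ : ∀ i, 0 ≤ E.P₀ i)
    -- choice of the decoupling variables
    (hϑ : ∀ k i, E.ϑ k i = Real.sqrt (((S.outNbrs (k + 1) i).card : ℝ) + 1))
    -- local uniform reachability
    (hreach : ∀ i, UniformlyReachable (fun k => S.A k i i) (fun k => CFC.sqrt (E.Q k i)))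
    -- boundedness of the parameters `Q` and `R`
    (hQR : ∀ i, ∃ qu ru rl : ℝ, 0 ≤ qu ∧ 0 < rl ∧ rl ≤ ru ∧ ∀ k : ℕ,
      (0 ≤ E.Q k i ∧ E.Q k i ≤ qu • (1 : Matrix (Fin (n i)) (Fin (n i)) ℝ)) ∧
      (rl • (1 : Matrix (Fin (m i)) (Fin (m i)) ℝ) ≤ E.R (k + 1) i ∧
        E.R (k + 1) i ≤ ru • (1 : Matrix (Fin (m i)) (Fin (m i)) ℝ)))
    -- boundedness of the solution of the Riccati recursion
    (hP : ∀ i, ∃ pu : ℝ, 0 ≤ pu ∧ ∀ k : ℕ,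
      S.P E k i ≤ pu • (1 : Matrix (Fin (n i)) (Fin (n i)) ℝ)) :
    ∃ b : ℝ, 0 ≤ b ∧ b < 1 ∧ ∀ ρ : ℝ, ∃ a : ℝ, 0 ≤ a ∧ ∀ δ : ℝ, ∃ c : ℝ, 0 ≤ c ∧
      ∀ (x₀ xh₀ : BlockVec n) (w : ℕ → BlockVec n) (v : ℕ → BlockVec m),
        euclNorm (stack (x₀ - xh₀)) ≤ ρ →
        (∀ k : ℕ, euclNorm (stack (w k)) ≤ δ) →
        (∀ k : ℕ, euclNorm (stack (v (k + 1))) ≤ δ) →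
        (∀ k : ℕ, euclNorm (stack (S.estError E x₀ xh₀ w v k)) ≤ a * b ^ k + c) ∧
        ((∀ k : ℕ, w k = 0) → (∀ k : ℕ, v (k + 1) = 0) →
          ∀ k : ℕ, euclNorm (stack (S.estError E x₀ xh₀ w v k)) ≤ a * b ^ k) := by
  obtain ⟨M, c, rl, ru, qu, pu, h⟩ := LIS.exists_hasBounds hA hC hP₀ hϑ hQR hP
  obtain ⟨a, b, ha, hb, hb1, hab⟩ := h.exists_closedLoop_bound hdet hreach
  have hκ := h.gainBound_nonneg
  have hc := h.c_pos
  set κ := LIS.pbarBound s M qu pu * c / rl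
  refine ⟨b, hb, hb1, fun ρ => ⟨a * max ρ 0, by positivity, fun δ =>
    ⟨a * ((1 + κ * c) * max δ 0 + κ * max δ 0) * (1 - b)⁻¹, ?_, fun x₀ xh₀ w v hρ hw hv => ?_⟩⟩⟩
  · have : 0 < 1 - b := by linarith
    positivity
  have hstep := LIS.stack_estError_succ (S := S) (E := E) x₀ xh₀ w v
  have h0 : a * euclNorm (stack (S.estError E x₀ xh₀ w v 0)) ≤ a * max ρ 0 :=
    mul_le_mul_of_nonneg_left (hρ.trans (le_max_left _ _)) ha
  refine ⟨fun k => ?_, fun hw0 hv0 k => ?_⟩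
  · refine (euclNorm_le_of_transition_bound ha hb hb1 hab
      (x := fun k => stack (S.estError E x₀ xh₀ w v k)) hstep (fun k => ?_) k).trans
      (add_le_add_left (mul_le_mul_of_nonneg_right h0 (pow_nonneg hb k)) _)
    refine (h.euclNorm_noise_le k (w k) (v (k + 1))).trans ?_
    have h1 := (hw k).trans (le_max_left δ 0)
    have h2 := (hv k).trans (le_max_left δ 0)
    gcongr
  · have hk := euclNorm_le_of_transition_bound (D := 0) ha hb hb1 hab
      (x := fun k => stack (S.estError E x₀ xh₀ w v k)) hstep (fun k => by
        have h1 := h.euclNorm_noise_le k (w k) (v (k + 1))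
        have h2 : ∀ d : Fin s → ℕ, euclNorm (stack (0 : BlockVec d)) = 0 := fun d => euclNorm_zero
        rw [hw0, hv0, h2, h2, mul_zero, mul_zero, add_zero] at h1
        rwa [hw0, hv0]) k
    rw [mul_zero, zero_mul, add_zero] at hk
    exact hk.trans (mul_le_mul_of_nonneg_right h0 (pow_nonneg hb k))
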